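/- **The system $\mathbf{CNF}^{\iota\prime}$.** Fix constants, predicate letters with numbers of places, and infinitely many parameters $a,b,\dots$ (free variables, distinct from the bound variables $x,y,\dots$). Terms and formulas are generated simultaneously: terms are constants, parameters (these two are the *atomic* terms) and definite descriptions $\iota xF$; formulas are $Rt_1\dots t_n$, $\exists!t$, $t=u$ (these three are *atomic*, and *prime* if all their terms are atomic), $\bot$, $A\to B$, $\forall xA$; $\neg A$ is $A\to\bot$. Formulas are taken up to renaming of bound variables, and $A^x_t$ is the result of replacing all free occurrences of $x$ in $A$ by $t$, also inside $\iota$-terms. Deductions are finite trees of formulas built from assumptions, which belong to labelled assumption classes (vacuous discharge is allowed), by the rules * $(\to I)$: from $B$ infer $A\to B$, discharging a class of $A$; $(\to E)$: from $A\to B$ and $A$ infer $B$; * $(\bot E_C)$: from $\bot$ infer an atomic $A$, discharging a class of $\neg A$; if the discharge is vacuous, $A$ must be prime; * $(\forall I)$: from $A^x_a$ infer $\forall xA$, discharging a class of $\exists!a$; $(\forall E)$: from $\forall xA$ and $\exists!t$ infer $A^x_t$, $t$ atomic; * $(=I^{nG})$: from $\exists!t$ (major premise) and $C$ (minor premise)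 infer $C$, discharging above the minor premise a class of $a=t$; $(=E)$: from $t_1=t_2$ (major premise) and $A^x_{t_1}$ (minor premise) infer $A^x_{t_2}$, $A$ atomic; * $(AD)$: from $Rt_1\dots t_n$ infer $\exists!t_i$, for $R$ a predicate letter or $=$; * $(\iota I)$: from $\exists!t$, $F^x_a$, $a=t$ infer $\iota xF=t$, $t$ atomic, discharging a class of $a=t$ above the second premise and classes of $F^x_a$ and of $\exists!a$ above the third; * $(\iota E_1)$: from $\iota xF=t$ and $u=t$ infer $F^x_u$; $(\iota E_2)$: from $\iota xF=t$, $F^x_u$ and $\exists!u$ infer $u=t$ ($t,u$ atomic in both); $(\iota E_3)$: from $\iota xF=t$ infer $\exists!t$ (every such instance of $(AD)$ counts as $(\iota E_3)$). In $(\forall I)$, $(=I^{nG})$, $(\iota I)$ the parameter $a$ does not occur in $\forall xA$, in $t$ and $C$, in $\iota xF$ and $t$, respectively, nor in the open assumptions of the subdeduction of the premise of $(\forall I)$, of the minor premise of $(=I^{nG})$, of the premises of $(\iota I)$, other than those the rule discharges. **Normal form.** The elimination rules are $(\to E)$, $(\forall E)$, $(\iota E_1)$, $(\iota E_2)$, $(\iota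 E_3)$, with the leftmost premise as major premise; the introduction rules are $(\to I)$, $(\forall I)$, $(\iota I)$, $(=I^{nG})$. A *segment* is a sequence $A_1,\dots,A_n$ ($n\ge1$) of formula occurrences of one of two kinds. First kind: each $A_i$, $i<n$, is the minor premise of an application of $(=I^{nG})$ with conclusion $A_{i+1}$; $A_1$ is not the conclusion and $A_n$ not the minor premise of $(=I^{nG})$. Second kind: each $A_i$, $i<n$, is the minor premise of an application of $(\to E)$ whose major premise is an assumption discharged by an application of $(\bot E_C)$ with conclusion $A_{i+1}$; $A_1$ is not the conclusion of $(\bot E_C)$, and $A_n$ is not a minor premise of an $(\to E)$ whose major premise is discharged by $(\bot E_C)$. An *$(=E)$-segment* is a sequence $\sigma_1,\dots,\sigma_m$ of segments such that the last formula of $\sigma_i$ ($i<m$) is the minor premise of an $(=E)$ whose conclusion is the first formula of $\sigma_{i+1}$, where $\sigma_1$ is minor premise but not conclusion of $(=E)$ and $\sigma_m$ is conclusion but not minor premise of $(=E)$. In what follows $(AD)$ includes $(\iota E_3)$. The *maximal* segments are: 1. segments whose last formula is the major premise of an elimination rule and which, if of length $1$, are the conclusion of an introduction rule; segments whose last formula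 is the conclusion of $(\bot E_C)$ and the major premise of an elimination rule or the premise of $(AD)$; 2. segments of formulas $t=t$ one of which is the minor premise of $(=I^{nG})$ and the last of which is the premise of $(AD)$; segments of formulas $a=t$ the first of which is an assumption discharged by an application of $(=I^{nG})$ with parameter $a$ and the last of which is the premise of $(AD)$ with conclusion $\exists!t$; 3. segments of formulas $\exists!t$ the first of which is concluded by $(AD)$ from $t=t$ and the last of which is the major premise of $(=I^{nG})$ with conclusion $t=t$; 4. $(=E)$-segments whose last segment is the premise of $(AD)$ or all of whose formulas have the form $\exists!t$. A deduction is in *normal form* if it contains no maximal segments and no vacuous application of $(=E)$, i.e. none whose minor premise and conclusion are the same formula. It is *regular* if every assumption discharged by $(\bot E_C)$ is the major premise of $(\to E)$. **Theorem.** Deductions in $\mathbf{CNF}^{\iota\prime}$ can be brought into normal form: for every deduction in $\mathbf{CNF}^{\iota\prime}$ there is a deduction in $\mathbf{CNF}^{\iota\prime}$ with the same conclusion, with all its open assumption classes among those of the given deduction, which is regular and in normal form. -/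

import Mathlib

namespace NFL

universe u v

/-- A signature: constants and predicate letters with their numbers of places. -/
structure Sig where
  Con : Type u
  Pred : Type v
  ar : Pred → ℕ

mutual
/-- Terms in which at most the bound variables `0, …, n-1` are loose (de Bruijn indices; the variable
of the innermost operator is `0`).  Parameters are numbered by `ℕ`.  The terms of the language are
the elements of `Tm S 0`. -/
inductive Tm (S : Sig.{u, v}) : ℕ → Type (max u v)
  | bv {n : ℕ} (k : Fin n) : Tm S n
  | par {n : ℕ} (a : ℕ) : Tm S n
  | con {n : ℕ} (c : S.Con) : Tm S n
  | iota {n : ℕ} (F : Fml S (n + 1)) : Tm S n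
/-- Formulas in which at most the bound variables `0, …, n-1` are loose.  The formulas of the
language are the elements of `Fml S 0`; `ex t` is the existence predicate applied to `t`. -/
inductive Fml (S : Sig.{u, v}) : ℕ → Type (max u v)
  | bot {n : ℕ} : Fml S n
  | pred {n : ℕ} (P : S.Pred) (ts : Fin (S.ar P) → Tm S n) : Fml S n
  | ex {n : ℕ} (t : Tm S n) : Fml S n
  | eq {n : ℕ} (s t : Tm S n) : Fml S n
  | imp {n : ℕ} (A B : Fml S n) : Fml S n
  | all {n : ℕ} (A : Fml S (n + 1)) : Fml S n
end

variable {S : Sig.{u, v}}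

/-- A renaming of loose variables, carried under one variable-binding operator. -/
def liftRen {m n : ℕ} (f : Fin m → Fin n) : Fin (m + 1) → Fin (n + 1) :=
  Fin.cases 0 (fun k => (f k).succ)

mutual
/-- Renaming of loose variables in a term. -/
def Tm.ren : {m : ℕ} → Tm S m → {n : ℕ} → (Fin m → Fin n) → Tm S n
  | _, .bv k, _, f => .bv (f k)
  | _, .par a, _, _ => .par a
  | _, .con c, _, _ => .con c
  | _, .iota F, _, f => .iota (F.ren (liftRen f))
/-- Renaming of loose variables in a formula. -/
def Fml.ren : {m : ℕ} → Fml S m → {n : ℕ} → (Fin m → Fin n) → Fml S n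
  | _, .bot, _, _ => .bot
  | _, .pred P ts, _, f => .pred P (fun k => (ts k).ren f)
  | _, .ex t, _, f => .ex (t.ren f)
  | _, .eq s t, _, f => .eq (s.ren f) (t.ren f)
  | _, .imp A B, _, f => .imp (A.ren f) (B.ren f)
  | _, .all A, _, f => .all (A.ren (liftRen f))
end

/-- A substitution for loose variables, carried under one variable-binding operator. -/
def liftSub {m n : ℕ} (f : Fin m → Tm S n) : Fin (m + 1) → Tm S (n + 1) :=
  Fin.cases (.bv 0) (fun k => (f k).ren Fin.succ)

mutual
/-- Capture-free substitution of terms for the loose variables of a term. -/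
def Tm.subst : {m : ℕ} → Tm S m → {n : ℕ} → (Fin m → Tm S n) → Tm S n
  | _, .bv k, _, f => f k
  | _, .par a, _, _ => .par a
  | _, .con c, _, _ => .con c
  | _, .iota F, _, f => .iota (F.subst (liftSub f))
/-- Capture-free substitution of terms for the loose variables of a formula. -/
def Fml.subst : {m : ℕ} → Fml S m → {n : ℕ} → (Fin m → Tm S n) → Fml S n
  | _, .bot, _, _ => .bot
  | _, .pred P ts, _, f => .pred P (fun k => (ts k).subst f)
  | _, .ex t, _, f => .ex (t.subst f)
  | _, .eq s t, _, f => .eq (s.subst f) (t.subst f)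
  | _, .imp A B, _, f => .imp (A.subst f) (B.subst f)
  | _, .all A, _, f => .all (A.subst (liftSub f))
end

/-- `A.inst t` replaces all free occurrences of the one loose variable of `A` by the term `t`
(also those inside definite descriptions). -/
def Fml.inst (A : Fml S 1) (t : Tm S 0) : Fml S 0 := A.subst (fun _ => t)

/-- Negation is defined. -/
def Fml.neg {n : ℕ} (A : Fml S n) : Fml S n := .imp A .bot

mutual
/-- The parameter `a` occurs in the term. -/
def Tm.HasPar (a : ℕ) : {n : ℕ} → Tm S n → Prop
  | _, .bv _ => False
  | _, .par b => b = a
  | _, .con _ => False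
  | _, .iota F => F.HasPar a
/-- The parameter `a` occurs in the formula. -/
def Fml.HasPar (a : ℕ) : {n : ℕ} → Fml S n → Prop
  | _, .bot => False
  | _, .pred _ ts => ∃ k, (ts k).HasPar a
  | _, .ex t => t.HasPar a
  | _, .eq s t => s.HasPar a ∨ t.HasPar a
  | _, .imp A B => A.HasPar a ∨ B.HasPar a
  | _, .all A => A.HasPar a
end

/-- Atomic terms: everything but definite descriptions. -/
def Tm.IsAtomic {n : ℕ} : Tm S n → Prop
  | .iota _ => False
  | _ => True

/-- Atomic formulas: formed from terms by predicate letters, the existence predicate, identity. -/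
def Fml.IsAtomic {n : ℕ} : Fml S n → Prop
  | .pred _ _ => True
  | .ex _ => True
  | .eq _ _ => True
  | _ => False

/-- Prime formulas: atomic formulas all of whose terms are atomic. -/
def Fml.IsPrime {n : ℕ} : Fml S n → Prop
  | .pred _ ts => ∀ k, (ts k).IsAtomic
  | .ex t => t.IsAtomic
  | .eq s t => s.IsAtomic ∧ t.IsAtomic
  | _ => False

/-- `A` is `R t₁ … tₙ`, for `R` a predicate letter or identity, and `t` is one of the `tᵢ`. -/
def Fml.HasArg {n : ℕ} (t : Tm S n) : Fml S n → Prop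
  | .pred _ ts => ∃ k, ts k = t
  | .eq s u => t = s ∨ t = u
  | _ => False

/-- Instances of the rules.  The numerals `i j k` are the labels of the assumption classes that are
discharged; an assumption class is a label together with a formula.  Making an assumption is the
rule `asm`. -/
inductive Rule (S : Sig.{u, v}) : Type (max u v)
  | asm (i : ℕ) (A : Fml S 0)
  | impI (i : ℕ) (A B : Fml S 0)
  | impE (A B : Fml S 0)
  | botC (i : ℕ) (A : Fml S 0)
  | allI (i a : ℕ) (A : Fml S 1)
  | allE (A : Fml S 1) (t : Tm S 0)
  | eqI (i a : ℕ) (t : Tm S 0) (C : Fml S 0)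
  | eqE (A : Fml S 1) (s t : Tm S 0)
  | ad (A : Fml S 0) (t : Tm S 0)
  | iotaI (i j k a : ℕ) (F : Fml S 1) (t : Tm S 0)
  | iotaE₁ (F : Fml S 1) (t u : Tm S 0)
  | iotaE₂ (F : Fml S 1) (t u : Tm S 0)
  | iotaE₃ (F : Fml S 1) (t : Tm S 0)

namespace Rule

/-- The conclusion of a rule instance. -/
def concl : Rule S → Fml S 0
  | asm _ A => A
  | impI _ A B => .imp A B
  | impE _ B => B
  | botC _ A => A
  | allI _ _ A => .all A
  | allE A t => A.inst t
  | eqI _ _ _ C => C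
  | eqE A _ t => A.inst t
  | ad _ t => .ex t
  | iotaI _ _ _ _ F t => .eq (.iota F) t
  | iotaE₁ F _ u => F.inst u
  | iotaE₂ _ t u => .eq u t
  | iotaE₃ _ t => .ex t

/-- The premises of a rule instance, from left to right. -/
def prems : Rule S → List (Fml S 0)
  | asm _ _ => []
  | impI _ _ B => [B]
  | impE A B => [.imp A B, A]
  | botC _ _ => [.bot]
  | allI _ a A => [A.inst (.par a)]
  | allE A t => [.all A, .ex t]
  | eqI _ _ t C => [.ex t, C]
  | eqE A s t => [.eq s t, A.inst s]
  | ad A _ => [A]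
  | iotaI _ _ _ a F t => [.ex t, F.inst (.par a), .eq (.par a) t]
  | iotaE₁ F t u => [.eq (.iota F) t, .eq u t]
  | iotaE₂ F t u => [.eq (.iota F) t, F.inst u, .ex u]
  | iotaE₃ F t => [.eq (.iota F) t]

/-- The assumption classes that a rule instance discharges above its premise number `n`
(premises are counted from `0`). -/
def disch : Rule S → ℕ → Set (ℕ × Fml S 0)
  | impI i A _, 0 => {(i, A)}
  | botC i A, 0 => {(i, A.neg)}
  | allI i a _, 0 => {(i, .ex (.par a))}
  | eqI i a t _, 1 => {(i, .eq (.par a) t)}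
  | iotaI i _ _ a _ t, 1 => {(i, .eq (.par a) t)}
  | iotaI _ j k a F _, 2 => {(j, F.inst (.par a)), (k, .ex (.par a))}
  | _, _ => ∅

/-- The restricted parameter of a rule instance that must not occur in the open assumptions above
premise number `n`, other than those discharged by the instance. -/
def eigen : Rule S → ℕ → Option ℕ
  | allI _ a _, _ => some a
  | eqI _ a _ _, 1 => some a
  | iotaI _ _ _ a _ _, _ => some a
  | _, _ => none

/-- The conditions on a rule instance that concern only the instance itself. -/
def Ok : Rule S → Prop
  | botC _ A => A.IsAtomic
  | allI _ a A => ¬ A.HasPar a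
  | allE _ t => t.IsAtomic
  | eqI _ a t C => ¬ t.HasPar a ∧ ¬ C.HasPar a
  | eqE A _ _ => A.IsAtomic
  | ad A t => A.HasArg t ∧ ∀ F, A ≠ .eq (.iota F) t -- the excluded case is `iotaE₃`
  | iotaI _ _ _ a F t => t.IsAtomic ∧ ¬ F.HasPar a ∧ ¬ t.HasPar a
  | iotaE₁ _ t u => t.IsAtomic ∧ u.IsAtomic
  | iotaE₂ _ t u => t.IsAtomic ∧ u.IsAtomic
  | _ => True

/-- Introduction rules. -/
def IsIntro : Rule S → Prop
  | impI _ _ _ => True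
  | allI _ _ _ => True
  | eqI _ _ _ _ => True
  | iotaI _ _ _ _ _ _ => True
  | _ => False

/-- Elimination rules (for the connective, the quantifier and the description operator).  The major
premise is the leftmost one, number `0`. -/
def IsElim : Rule S → Prop
  | impE _ _ => True
  | allE _ _ => True
  | iotaE₁ _ _ _ => True
  | iotaE₂ _ _ _ => True
  | iotaE₃ _ _ => True
  | _ => False

/-- The rule of atomic denotation, including its special case `iotaE₃`. -/
def IsAD : Rule S → Prop
  | ad _ _ => True
  | iotaE₃ _ _ => True
  | _ => False

/-- Identity introduction (in its general form). -/
def IsEqI : Rule S → Prop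
  | eqI _ _ _ _ => True
  | _ => False

/-- Identity elimination. -/
def IsEqE : Rule S → Prop
  | eqE _ _ _ => True
  | _ => False

/-- Implication elimination. -/
def IsImpE : Rule S → Prop
  | impE _ _ => True
  | _ => False

/-- Classical reductio. -/
def IsBotC : Rule S → Prop
  | botC _ _ => True
  | _ => False

/-- Applications of identity elimination whose minor premise and conclusion are the same formula. -/
def IsVacuousEqE : Rule S → Prop
  | eqE A s t => A.inst s = A.inst t
  | _ => False

end Rule

/-- Trees of rule instances, with one subtree for each premise. -/
inductive Ded (S : Sig.{u, v}) : Type (max u v)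
  | node (r : Rule S) (ds : Fin r.prems.length → Ded S) : Ded S

/-- Positions in a tree: the sequence of premise numbers met on the way up from the root.  They serve
as names of formula occurrences. -/
abbrev Pos := List ℕ

namespace Ded

/-- The last rule. -/
def rule : Ded S → Rule S
  | node r _ => r

/-- The formula at the root. -/
def concl (D : Ded S) : Fml S 0 := D.rule.concl

/-- The open assumption classes. -/
def openAsm : Ded S → Set (ℕ × Fml S 0)
  | node r ds => {c | r = .asm c.1 c.2} ∪ ⋃ n, (openAsm (ds n) \ r.disch n)

/-- The tree is a deduction in the system: every premise is the conclusion of its subtree, the side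
conditions of the rules are met, and reductio with vacuous discharge has a prime conclusion. -/
def Correct : Ded S → Prop
  | node r ds =>
    (∀ n, Correct (ds n)) ∧ (∀ n, (ds n).concl = r.prems.get n) ∧ r.Ok ∧
    (∀ (n : Fin r.prems.length) (a : ℕ), r.eigen n = some a →
      ∀ c ∈ (ds n).openAsm, c ∉ r.disch n → ¬ c.2.HasPar a) ∧
    (∀ i A, r = .botC i A → A.IsPrime ∨ ∃ n, (i, A.neg) ∈ (ds n).openAsm)

/-- The subtree at a position. -/
def sub : Ded S → Pos → Option (Ded S)
  | D, [] => some D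
  | node r ds, n :: p => if h : n < r.prems.length then (ds ⟨n, h⟩).sub p else none

/-- The rule by which the occurrence at a position is concluded. -/
def ruleAt (D : Ded S) (p : Pos) : Option (Rule S) := (D.sub p).map rule

/-- The formula at a position. -/
def fmlAt (D : Ded S) (p : Pos) : Option (Fml S 0) := (D.ruleAt p).map Rule.concl

/-- The occurrence `p` is concluded by a rule with the property `R`. -/
def ConcludedBy (D : Ded S) (R : Rule S → Prop) (p : Pos) : Prop :=
  ∃ r, D.ruleAt p = some r ∧ R r

/-- The occurrence `p` is premise number `n` of a rule with the property `R`. -/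
def PremiseOf (D : Ded S) (n : ℕ) (R : Rule S → Prop) (p : Pos) : Prop :=
  ∃ q, p = q ++ [n] ∧ D.ConcludedBy R q

/-- The occurrence `p` is an assumption discharged by the rule application with conclusion `q`: this
application, and none in between, discharges its assumption class. -/
def DischargedAt (D : Ded S) (p q : Pos) : Prop :=
  ∃ i A, D.ruleAt p = some (.asm i A) ∧
    (∃ n s r, p = q ++ n :: s ∧ D.ruleAt q = some r ∧ (i, A) ∈ r.disch n) ∧
    ∀ q' n s r, p = q' ++ n :: s → D.ruleAt q' = some r → q.length < q'.length →
      (i, A) ∉ r.disch n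

/-- `p` is the minor premise, `q` the conclusion of an application of `eqI`. -/
def EqLink (D : Ded S) (p q : Pos) : Prop :=
  p = q ++ [1] ∧ D.ConcludedBy Rule.IsEqI q

/-- `p` is the minor premise of an application of `impE` the major premise of which is discharged by
the application of `botC` with conclusion `q`. -/
def BotLink (D : Ded S) (p q : Pos) : Prop :=
  ∃ p', p = p' ++ [1] ∧ D.ConcludedBy Rule.IsImpE p' ∧ D.DischargedAt (p' ++ [0]) q ∧
    D.ConcludedBy Rule.IsBotC q

/-- Segments arising from `eqI`. -/
def IsEqSegment (D : Ded S) (l : List Pos) : Prop :=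
  l.IsChain D.EqLink ∧
  (∃ p, l.head? = some p ∧ D.ConcludedBy (fun r => ¬ r.IsEqI) p) ∧
  (∃ p, l.getLast? = some p ∧ ∀ q, ¬ D.EqLink p q)

/-- Segments arising from `botC`. -/
def IsBotSegment (D : Ded S) (l : List Pos) : Prop :=
  l.IsChain D.BotLink ∧
  (∃ p, l.head? = some p ∧ D.ConcludedBy (fun r => ¬ r.IsBotC) p) ∧
  (∃ p, l.getLast? = some p ∧ ∀ q, ¬ D.BotLink p q)

/-- Segments of either kind. -/
def IsSegment (D : Ded S) (l : List Pos) : Prop := D.IsEqSegment l ∨ D.IsBotSegment l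

/-- Maximal segments in the sense of introduction and elimination, and of reductio followed by an
elimination rule or by the rule of atomic denotation. -/
def IsMaxIESegment (D : Ded S) (l : List Pos) : Prop :=
  D.IsSegment l ∧ ∃ p, l.getLast? = some p ∧
    ((D.PremiseOf 0 Rule.IsElim p ∧ (l.length = 1 → D.ConcludedBy Rule.IsIntro p)) ∨
     (D.ConcludedBy Rule.IsBotC p ∧
       (D.PremiseOf 0 Rule.IsElim p ∨ D.PremiseOf 0 Rule.IsAD p)))

/-- Maximal identity segments: (i) segments of formulas `t = t` one of which is minor premise of
`eqI` and the last of which is premise of the rule of atomic denotation; (ii) segments of formulas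
`a = t` the first of which is discharged by an application of `eqI` with restricted parameter `a` and
the last of which is premise of the rule of atomic denotation with conclusion `∃! t`. -/
def IsMaxEqSegment (D : Ded S) (l : List Pos) : Prop :=
  D.IsSegment l ∧
  ((∃ t, (∀ p ∈ l, D.fmlAt p = some (.eq t t)) ∧
      (∃ p ∈ l, D.PremiseOf 1 Rule.IsEqI p) ∧
      (∃ p, l.getLast? = some p ∧ D.PremiseOf 0 Rule.IsAD p)) ∨
   (∃ a t, (∀ p ∈ l, D.fmlAt p = some (.eq (.par a) t)) ∧
      (∃ p q, l.head? = some p ∧ D.DischargedAt p q ∧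
        D.ConcludedBy (fun r => ∃ i C, r = .eqI i a t C) q) ∧
      (∃ p, l.getLast? = some p ∧
        D.PremiseOf 0 (fun r => r.IsAD ∧ r.concl = .ex t) p)))

/-- Maximal existence segments: segments of formulas `∃! t` the first of which is concluded by the
rule of atomic denotation from `t = t`, and the last of which is the major premise of an application
of `eqI` with conclusion `t = t`. -/
def IsMaxExSegment (D : Ded S) (l : List Pos) : Prop :=
  D.IsSegment l ∧ ∃ t, (∀ p ∈ l, D.fmlAt p = some (.ex t)) ∧
    (∃ p, l.head? = some p ∧ D.ConcludedBy (fun r => r.IsAD ∧ r.prems = [.eq t t]) p) ∧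
    (∃ p, l.getLast? = some p ∧ D.PremiseOf 0 (fun r => r.IsEqI ∧ r.concl = .eq t t) p)

/-- The last formula of `l` is the minor premise, the first formula of `l'` the conclusion of an
application of `eqE`. -/
def EqELink (D : Ded S) (l l' : List Pos) : Prop :=
  ∃ q, l.getLast? = some (q ++ [1]) ∧ l'.head? = some q ∧ D.ConcludedBy Rule.IsEqE q

/-- `l` is minor premise of `eqE`. -/
def SegMinorEqE (D : Ded S) (l : List Pos) : Prop :=
  ∃ p, l.getLast? = some p ∧ D.PremiseOf 1 Rule.IsEqE p

/-- `l` is conclusion of `eqE`. -/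
def SegConclEqE (D : Ded S) (l : List Pos) : Prop :=
  ∃ p, l.head? = some p ∧ D.ConcludedBy Rule.IsEqE p

/-- Sequences of segments that are linked by applications of `eqE`, extended as far as possible in
both directions. -/
def IsEqESegment (D : Ded S) (L : List (List Pos)) : Prop :=
  (∀ l ∈ L, D.IsSegment l) ∧ L.IsChain D.EqELink ∧
  (∃ l, L.head? = some l ∧ D.SegMinorEqE l ∧ ¬ D.SegConclEqE l) ∧
  (∃ l, L.getLast? = some l ∧ D.SegConclEqE l ∧ ¬ D.SegMinorEqE l)

/-- Maximal `eqE`-segments: the last segment is premise of the rule of atomic denotation, or all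
formulas are formed by the existence predicate. -/
def IsMaxEqESegment (D : Ded S) (L : List (List Pos)) : Prop :=
  D.IsEqESegment L ∧
  ((∃ l p, L.getLast? = some l ∧ l.getLast? = some p ∧ D.PremiseOf 0 Rule.IsAD p) ∨
   (∀ l ∈ L, ∀ p ∈ l, ∃ t, D.fmlAt p = some (.ex t)))

/-- Normal form: no maximal segments of any kind, and no vacuous applications of `eqE`. -/
def Normal (D : Ded S) : Prop :=
  (∀ l, ¬ D.IsMaxIESegment l) ∧ (∀ l, ¬ D.IsMaxEqSegment l) ∧ (∀ l, ¬ D.IsMaxExSegment l) ∧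
  (∀ L, ¬ D.IsMaxEqESegment L) ∧ (∀ p, ¬ D.ConcludedBy Rule.IsVacuousEqE p)

/-- Regular deductions: every assumption discharged by `botC` is the major premise of `impE`. -/
def Regular (D : Ded S) : Prop :=
  ∀ p q, D.DischargedAt p q → D.ConcludedBy Rule.IsBotC q → D.PremiseOf 0 Rule.IsImpE p

end Ded

end NFL

-- The proof is semantic: no reduction steps are performed. The given deduction is evaluated in a
-- Kripke-style model built from normal deductions, and a normal deduction of its conclusion is read
-- off from the value (normalization by evaluation).
--
-- Normality speaks of segments of unbounded length, so it is replaced by a stronger local property,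
-- `Ded.Good`. Label `K` is reserved for `botC`, label `K + 1` for `eqI`, and `eqI` may only
-- conclude `⊥`. Long `eqI`-segments then consist of `⊥`, which no elimination or denotation rule
-- takes as major premise, and all that remains are conditions on rule instances and adjacent pairs.
-- `Good.regular` and `Good.normal` recover the required properties. `Nf` is derivability by good
-- deductions, `Ne` the restriction to deductions that may stand above any elimination or denotation
-- rule.
--
-- Worlds are finite sets of assumption classes. Quantifiers range over existing atomic terms, as in
-- `allE`, so forcing is defined by structural recursion. Terms have partial values among atomic
-- terms up to derivable identity; the clause for descriptions copies the premises of `iotaI`.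
-- Atomic formulas are forced up to `J`, a double negation relative to derivable falsity, which
-- makes forcing closed under reductio. Soundness (`Ded.Correct.force`) is an induction on arbitrary
-- correct deductions.
--
-- The return to syntax is a simultaneous induction: forced formulas have good deductions
-- (`Fml.reify`), and formulas with neutral deductions are forced (`Fml.reflect`). A description has
-- no atomic term at hand as its value, so reflection of atomic formulas names the terms by `eqI`.
-- Under `J` the goal is `⊥`, which is why `eqI` with conclusion `⊥` suffices. Open assumptions with
-- labels below `K` are neutral, hence forced; by soundness the conclusion is forced, and
-- reification yields the normal deduction.

namespace NFL

universe u v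

variable {S : Sig.{u, v}}

/-! ### Substitution calculus -/

/-- Extension of an environment by a value for the innermost variable. -/
def push {α : Type*} {n : ℕ} (x : α) (ρ : Fin n → α) : Fin (n + 1) → α := Fin.cases x ρ

@[simp] theorem push_succ {α : Type*} {n : ℕ} (x : α) (ρ : Fin n → α) (k : Fin n) :
    push x ρ k.succ = ρ k := rfl

@[simp] theorem liftSub_succ {m n : ℕ} (f : Fin m → Tm S n) (k : Fin m) :
    liftSub f k.succ = (f k).ren Fin.succ := rfl

theorem liftRen_comp {m n k : ℕ} (f : Fin m → Fin n) (g : Fin n → Fin k) :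
    liftRen g ∘ liftRen f = liftRen (g ∘ f) := by
  funext i; refine Fin.cases rfl (fun i => rfl) i

theorem liftSub_comp_liftRen {m n k : ℕ} (f : Fin m → Fin n) (g : Fin n → Tm S k) :
    liftSub g ∘ liftRen f = liftSub (g ∘ f) := by
  funext i; refine Fin.cases rfl (fun i => rfl) i

theorem push_comp_liftRen {α : Type*} {m n : ℕ} (f : Fin m → Fin n) (x : α) (ρ : Fin n → α) :
    push x ρ ∘ liftRen f = push x (ρ ∘ f) := by
  funext i; refine Fin.cases rfl (fun i => rfl) i

mutual
theorem Tm.ren_ren : ∀ {m : ℕ} (t : Tm S m) {n k : ℕ} (f : Fin m → Fin n) (g : Fin n → Fin k),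
    (t.ren f).ren g = t.ren (g ∘ f)
  | _, .bv _, _, _, _, _ => rfl
  | _, .par _, _, _, _, _ => rfl
  | _, .con _, _, _, _, _ => rfl
  | _, .iota F, _, _, f, g => by
    simp only [Tm.ren, Fml.ren_ren F, liftRen_comp]
theorem Fml.ren_ren : ∀ {m : ℕ} (A : Fml S m) {n k : ℕ} (f : Fin m → Fin n) (g : Fin n → Fin k),
    (A.ren f).ren g = A.ren (g ∘ f)
  | _, .bot, _, _, _, _ => rfl
  | _, .pred _ ts, _, _, _, _ => by
    simp only [Fml.ren]
    congr 1
    funext k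
    exact Tm.ren_ren (ts k) _ _
  | _, .ex t, _, _, _, _ => by simp only [Fml.ren, Tm.ren_ren t]
  | _, .eq s t, _, _, _, _ => by simp only [Fml.ren, Tm.ren_ren s, Tm.ren_ren t]
  | _, .imp A B, _, _, _, _ => by simp only [Fml.ren, Fml.ren_ren A, Fml.ren_ren B]
  | _, .all A, _, _, _, _ => by simp only [Fml.ren, Fml.ren_ren A, liftRen_comp]
end

mutual
theorem Tm.ren_subst : ∀ {m : ℕ} (t : Tm S m) {n k : ℕ} (f : Fin m → Fin n) (g : Fin n → Tm S k),
    (t.ren f).subst g = t.subst (g ∘ f)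
  | _, .bv _, _, _, _, _ => rfl
  | _, .par _, _, _, _, _ => rfl
  | _, .con _, _, _, _, _ => rfl
  | _, .iota F, _, _, f, g => by
    simp only [Tm.ren, Tm.subst, Fml.ren_subst F, liftSub_comp_liftRen]
theorem Fml.ren_subst : ∀ {m : ℕ} (A : Fml S m) {n k : ℕ} (f : Fin m → Fin n) (g : Fin n → Tm S k),
    (A.ren f).subst g = A.subst (g ∘ f)
  | _, .bot, _, _, _, _ => rfl
  | _, .pred _ ts, _, _, _, _ => by
    simp only [Fml.ren, Fml.subst]
    congr 1
    funext k
    exact Tm.ren_subst (ts k) _ _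
  | _, .ex t, _, _, _, _ => by simp only [Fml.ren, Fml.subst, Tm.ren_subst t]
  | _, .eq s t, _, _, _, _ => by
    simp only [Fml.ren, Fml.subst, Tm.ren_subst s, Tm.ren_subst t]
  | _, .imp A B, _, _, _, _ => by
    simp only [Fml.ren, Fml.subst, Fml.ren_subst A, Fml.ren_subst B]
  | _, .all A, _, _, _, _ => by
    simp only [Fml.ren, Fml.subst, Fml.ren_subst A, liftSub_comp_liftRen]
end

theorem liftRen_comp_liftSub {m n k : ℕ} (f : Fin m → Tm S n) (g : Fin n → Fin k) :
    (fun i => (liftSub f i).ren (liftRen g)) = liftSub (fun i => (f i).ren g) := by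
  funext i
  refine Fin.cases rfl (fun i => ?_) i
  simp only [liftSub_succ, Tm.ren_ren]
  rfl

mutual
theorem Tm.subst_ren : ∀ {m : ℕ} (t : Tm S m) {n k : ℕ} (f : Fin m → Tm S n) (g : Fin n → Fin k),
    (t.subst f).ren g = t.subst (fun i => (f i).ren g)
  | _, .bv _, _, _, _, _ => rfl
  | _, .par _, _, _, _, _ => rfl
  | _, .con _, _, _, _, _ => rfl
  | _, .iota F, _, _, f, g => by
    simp only [Tm.ren, Tm.subst, Fml.subst_ren F, liftRen_comp_liftSub]
theorem Fml.subst_ren : ∀ {m : ℕ} (A : Fml S m) {n k : ℕ} (f : Fin m → Tm S n) (g : Fin n → Fin k),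
    (A.subst f).ren g = A.subst (fun i => (f i).ren g)
  | _, .bot, _, _, _, _ => rfl
  | _, .pred _ ts, _, _, _, _ => by
    simp only [Fml.ren, Fml.subst]
    congr 1
    funext k
    exact Tm.subst_ren (ts k) _ _
  | _, .ex t, _, _, _, _ => by simp only [Fml.ren, Fml.subst, Tm.subst_ren t]
  | _, .eq s t, _, _, _, _ => by
    simp only [Fml.ren, Fml.subst, Tm.subst_ren s, Tm.subst_ren t]
  | _, .imp A B, _, _, _, _ => by
    simp only [Fml.ren, Fml.subst, Fml.subst_ren A, Fml.subst_ren B]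
  | _, .all A, _, _, _, _ => by
    simp only [Fml.ren, Fml.subst, Fml.subst_ren A, liftRen_comp_liftSub]
end

theorem liftSub_comp {m n k : ℕ} (f : Fin m → Tm S n) (g : Fin n → Tm S k) :
    (fun i => (liftSub f i).subst (liftSub g)) = liftSub (fun i => (f i).subst g) := by
  funext i
  refine Fin.cases rfl (fun i => ?_) i
  simp only [liftSub_succ, Tm.ren_subst, Tm.subst_ren]
  rfl

mutual
theorem Tm.subst_subst : ∀ {m : ℕ} (t : Tm S m) {n k : ℕ} (f : Fin m → Tm S n)
    (g : Fin n → Tm S k), (t.subst f).subst g = t.subst (fun i => (f i).subst g)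
  | _, .bv _, _, _, _, _ => rfl
  | _, .par _, _, _, _, _ => rfl
  | _, .con _, _, _, _, _ => rfl
  | _, .iota F, _, _, f, g => by
    simp only [Tm.subst, Fml.subst_subst F, liftSub_comp]
theorem Fml.subst_subst : ∀ {m : ℕ} (A : Fml S m) {n k : ℕ} (f : Fin m → Tm S n)
    (g : Fin n → Tm S k), (A.subst f).subst g = A.subst (fun i => (f i).subst g)
  | _, .bot, _, _, _, _ => rfl
  | _, .pred _ ts, _, _, _, _ => by
    simp only [Fml.subst]
    congr 1
    funext k
    exact Tm.subst_subst (ts k) _ _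
  | _, .ex t, _, _, _, _ => by simp only [Fml.subst, Tm.subst_subst t]
  | _, .eq s t, _, _, _, _ => by
    simp only [Fml.subst, Tm.subst_subst s, Tm.subst_subst t]
  | _, .imp A B, _, _, _, _ => by
    simp only [Fml.subst, Fml.subst_subst A, Fml.subst_subst B]
  | _, .all A, _, _, _, _ => by
    simp only [Fml.subst, Fml.subst_subst A, liftSub_comp]
end

theorem liftSub_bv {n : ℕ} : liftSub (fun k : Fin n => (.bv k : Tm S n)) = fun k => .bv k := by
  funext i
  refine Fin.cases rfl (fun i => rfl) i

mutual
theorem Tm.subst_bv : ∀ {n : ℕ} (t : Tm S n), t.subst (fun k => .bv k) = t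
  | _, .bv _ => rfl
  | _, .par _ => rfl
  | _, .con _ => rfl
  | _, .iota F => by simp only [Tm.subst, liftSub_bv, Fml.subst_bv F]
theorem Fml.subst_bv : ∀ {n : ℕ} (A : Fml S n), A.subst (fun k => .bv k) = A
  | _, .bot => rfl
  | _, .pred _ ts => by simp only [Fml.subst, fun k => Tm.subst_bv (ts k)]
  | _, .ex t => by simp only [Fml.subst, Tm.subst_bv t]
  | _, .eq s t => by simp only [Fml.subst, Tm.subst_bv s, Tm.subst_bv t]
  | _, .imp A B => by simp only [Fml.subst, Fml.subst_bv A, Fml.subst_bv B]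
  | _, .all A => by simp only [Fml.subst, liftSub_bv, Fml.subst_bv A]
end

theorem Tm.subst_closed (t : Tm S 0) (f : Fin 0 → Tm S 0) : t.subst f = t := by
  rw [Subsingleton.elim f (fun k => .bv k), Tm.subst_bv]

theorem Fml.subst_closed (A : Fml S 0) (f : Fin 0 → Tm S 0) : A.subst f = A := by
  rw [Subsingleton.elim f (fun k => .bv k), Fml.subst_bv]

/-- A term of the language, regarded as a term with one (vacuous) loose variable. -/
def Tm.wk (t : Tm S 0) : Tm S 1 := t.ren Fin.elim0

@[simp] theorem Tm.wk_subst (t : Tm S 0) (f : Fin 1 → Tm S 0) : t.wk.subst f = t := by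
  rw [Tm.wk, Tm.ren_subst, Tm.subst_closed]

theorem Fml.subst_liftSub_inst {n : ℕ} (A : Fml S (n + 1)) (f : Fin n → Tm S 0) (u : Tm S 0) :
    (A.subst (liftSub f)).inst u = A.subst (push u f) := by
  rw [Fml.inst, Fml.subst_subst]
  congr 1
  funext i
  refine Fin.cases rfl (fun i => ?_) i
  simp only [liftSub_succ, push_succ, Tm.ren_subst, Tm.subst_closed]

/-! ### Finitely many parameters -/

mutual
theorem Tm.finite_hasPar : ∀ {n : ℕ} (t : Tm S n), {a | t.HasPar a}.Finite
  | _, .bv _ => by simp [Tm.HasPar]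
  | _, .par b => by simp [Tm.HasPar]
  | _, .con _ => by simp [Tm.HasPar]
  | _, .iota F => by simpa only [Tm.HasPar] using Fml.finite_hasPar F
theorem Fml.finite_hasPar : ∀ {n : ℕ} (A : Fml S n), {a | A.HasPar a}.Finite
  | _, .bot => by simp [Fml.HasPar]
  | _, .pred _ ts => by
    simp only [Fml.HasPar, Set.ofPred_exists]
    exact Set.finite_iUnion fun k => Tm.finite_hasPar (ts k)
  | _, .ex t => by simpa only [Fml.HasPar] using Tm.finite_hasPar t
  | _, .eq s t => by
    simpa only [Fml.HasPar, Set.ofPred_or] using (Tm.finite_hasPar s).union (Tm.finite_hasPar t)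
  | _, .imp A B => by
    simpa only [Fml.HasPar, Set.ofPred_or] using (Fml.finite_hasPar A).union (Fml.finite_hasPar B)
  | _, .all A => by simpa only [Fml.HasPar] using Fml.finite_hasPar A
end

/-- For finitely many assumption classes and any two formulas there is a new parameter. -/
theorem exists_fresh {Γ : Set (ℕ × Fml S 0)} (hΓ : Γ.Finite) {m n : ℕ} (A : Fml S m)
    (B : Fml S n) :
    ∃ a, (∀ c ∈ Γ, ¬ c.2.HasPar a) ∧ ¬ A.HasPar a ∧ ¬ B.HasPar a := by
  have h : ({a | ∃ c ∈ Γ, c.2.HasPar a} ∪ ({a | A.HasPar a} ∪ {a | B.HasPar a})).Finite := by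
    refine Set.Finite.union ?_ (A.finite_hasPar.union B.finite_hasPar)
    have : {a | ∃ c ∈ Γ, c.2.HasPar a} = ⋃ c ∈ Γ, {a | c.2.HasPar a} := by ext; simp
    rw [this]
    exact hΓ.biUnion fun c _ => c.2.finite_hasPar
  obtain ⟨a, ha⟩ := h.exists_notMem
  simp only [Set.mem_union, Set.mem_ofPred_eq, not_or, not_exists, not_and] at ha
  exact ⟨a, ha.1, ha.2⟩

/-! ### A local criterion for regularity and normality -/

/-- Conditions on single rule instances; `K` is the label reserved for `botC`, `K + 1` the one
reserved for `eqI`. -/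
structure Rule.NodeOk (K : ℕ) (r : Rule S) : Prop where
  botC : ∀ i A, r = .botC i A → i = K
  eqI : ∀ i a t C, r = .eqI i a t C → i = K + 1 ∧ C = .bot
  eqE : r.IsEqE → ¬ r.IsVacuousEqE ∧ ∀ t, r.concl ≠ .ex t

/-- Conditions on a rule instance `r` and the rule instance `r'` that concludes its premise number
`n`. -/
structure Rule.Edge (K : ℕ) (r : Rule S) (n : ℕ) (r' : Rule S) : Prop where
  asm : ∀ A, r' = .asm K A → r.IsImpE ∧ n = 0
  elim : r.IsElim → n = 0 → ¬ r'.IsIntro ∧ ¬ r'.IsBotC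
  ad : r.IsAD → n = 0 → ¬ r'.IsBotC ∧ ¬ r'.IsEqE ∧ ¬ r'.IsEqI ∧
    ∀ a t, r' = .asm (K + 1) (.eq (.par a) t) → r.concl ≠ .ex t
  eqI : r.IsEqI → n = 1 → r'.concl = .bot

namespace Ded

/-- All rule instances and all pairs of adjacent rule instances satisfy the local conditions. -/
def Good (K : ℕ) : Ded S → Prop
  | node r ds => r.NodeOk K ∧ ∀ n : Fin r.prems.length, r.Edge K n (ds n).rule ∧ Good K (ds n)

variable {K : ℕ} {D : Ded S}

theorem Good.nodeOk (h : D.Good K) : D.rule.NodeOk K := by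
  cases D; exact h.1

theorem Good.sub : ∀ (p : Pos) {D D' : Ded S}, D.Good K → D.sub p = some D' → D'.Good K
  | [], D, D', h, e => by
    cases D; simp only [Ded.sub, Option.some.injEq] at e; subst e; exact h
  | n :: p, .node r ds, D', h, e => by
    simp only [Ded.sub] at e
    split at e
    · exact Good.sub p (h.2 _).2 e
    · cases e

theorem sub_append : ∀ (p q : Pos) (D : Ded S), D.sub (p ++ q) = (D.sub p).bind (·.sub q)
  | [], q, D => by cases D; simp [Ded.sub]
  | n :: p, q, .node r ds => by
    simp only [List.cons_append, Ded.sub]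
    split
    · exact sub_append p q _
    · rfl

theorem Good.ruleAt (h : D.Good K) {p : Pos} {r : Rule S} (hr : D.ruleAt p = some r) :
    r.NodeOk K := by
  obtain ⟨D', hD', rfl⟩ := Option.map_eq_some_iff.1 hr
  exact (Good.sub p h hD').nodeOk

theorem Good.edge (h : D.Good K) {p : Pos} {n : ℕ} {r r' : Rule S} (hr : D.ruleAt p = some r)
    (hr' : D.ruleAt (p ++ [n]) = some r') : r.Edge K n r' := by
  obtain ⟨⟨r₀, ds⟩, hD', rfl⟩ := Option.map_eq_some_iff.1 hr
  have hg := Good.sub p h hD'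
  rw [Ded.ruleAt, sub_append, hD'] at hr'
  simp only [Option.bind_some, Ded.sub] at hr'
  split at hr'
  · rename_i hn
    cases e : ds ⟨n, hn⟩ with
    | node r₁ ds₁ =>
      have h2 := (hg.2 ⟨n, hn⟩).1
      rw [e] at hr' h2
      simp only [Option.map_some, Option.some.injEq] at hr'
      rw [← hr']
      exact h2
  · cases hr'

theorem ConcludedBy.of_ruleAt {R : Rule S → Prop} {p : Pos} {r : Rule S}
    (h : D.ConcludedBy R p) (hr : D.ruleAt p = some r) : R r := by
  obtain ⟨r', h1, h2⟩ := h
  rw [hr] at h1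
  cases h1
  exact h2

theorem EqLink.concludedBy {p q : Pos} (h : D.EqLink p q) : D.ConcludedBy Rule.IsEqI q := h.2

theorem BotLink.concludedBy {p q : Pos} (h : D.BotLink p q) : D.ConcludedBy Rule.IsBotC q := by
  obtain ⟨_, _, _, _, h⟩ := h
  exact h

/-- The last link of a longer segment, of either kind, names the rule that concludes its last
formula. Local conditions on that rule can therefore control segments of any length. -/
theorem IsSegment.last_cases {l : List Pos} (h : D.IsSegment l) {p : Pos}
    (hp : l.getLast? = some p) :
    l = [p] ∨ D.ConcludedBy Rule.IsEqI p ∨ D.ConcludedBy Rule.IsBotC p := by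
  obtain ⟨l', rfl⟩ := List.getLast?_eq_some_iff.1 hp
  rcases List.eq_nil_or_concat l' with rfl | ⟨l'', x, rfl⟩
  · exact .inl rfl
  · right
    rcases h with h | h
    · have h1 := h.1
      simp only [List.concat_eq_append, List.append_assoc, List.isChain_append] at h1
      left
      have := h1.2.1
      simp at this
      exact this.concludedBy
    · have h1 := h.1
      simp only [List.concat_eq_append, List.append_assoc, List.isChain_append] at h1
      right
      have := h1.2.1
      simp at this
      exact this.concludedBy

theorem PremiseOf.edge (hD : D.Good K) {n : ℕ} {R R' : Rule S → Prop} {p : Pos}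
    (h : D.PremiseOf n R p) (h' : D.ConcludedBy R' p) : ∃ r r', R r ∧ R' r' ∧ r.Edge K n r' := by
  obtain ⟨q, rfl, r, hr, hR⟩ := h
  obtain ⟨r', hr', hR'⟩ := h'
  exact ⟨r, r', hR, hR', hD.edge hr hr'⟩

theorem IsSegment.eq_singleton_of_premiseOf_ad (hD : D.Good K) {R : Rule S → Prop}
    (hR : ∀ r, R r → r.IsAD) {l : List Pos} (h : D.IsSegment l) {p : Pos}
    (hp : l.getLast? = some p) (hp' : D.PremiseOf 0 R p) : l = [p] := by
  rcases h.last_cases hp with h | h | h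
  · exact h
  · obtain ⟨r, r', h1, h2, h3⟩ := hp'.edge hD h
    exact absurd h2 (h3.ad (hR _ h1) rfl).2.2.1
  · obtain ⟨r, r', h1, h2, h3⟩ := hp'.edge hD h
    exact absurd h2 (h3.ad (hR _ h1) rfl).1

/-- An assumption discharged by `botC` carries the label `K`, and `Edge.asm` allows such an
assumption only as the major premise of `impE`. -/
theorem Good.regular (hD : D.Good K) : D.Regular := by
  rintro p q ⟨i, A, hp, ⟨n, s, r, rfl, hr, hd⟩, -⟩ hb
  have hb' := hb.of_ruleAt hr
  have hi : i = K := by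
    cases r <;> try exact hb'.elim
    rename_i j B
    have := (hD.ruleAt hr).botC j B rfl
    subst this
    match n, hd with
    | 0, hd => simp only [Rule.disch, Set.mem_singleton_iff, Prod.mk.injEq] at hd; exact hd.1
  subst hi
  obtain ⟨s', m, hs⟩ : ∃ s' m, q ++ n :: s = s' ++ [m] := by
    rcases List.eq_nil_or_concat (q ++ n :: s) with h | ⟨s', m, h⟩
    · simp at h
    · exact ⟨s', m, by simpa using h⟩
  rw [hs] at hp ⊢
  obtain ⟨r', hr'⟩ : ∃ r', D.ruleAt s' = some r' := by
    obtain ⟨D', hD', -⟩ := Option.map_eq_some_iff.1 hp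
    rw [sub_append] at hD'
    obtain ⟨D'', h1, -⟩ := Option.bind_eq_some_iff.1 hD'
    exact ⟨D''.rule, by rw [Ded.ruleAt, h1]; rfl⟩
  have := (hD.edge hr' hp).asm A rfl
  rw [this.2]
  exact ⟨s', rfl, r', hr', this.1⟩

theorem Good.not_isMaxIESegment (hD : D.Good K) (l : List Pos) : ¬ D.IsMaxIESegment l := by
  have bad : ∀ p r', D.PremiseOf 0 Rule.IsElim p → D.ruleAt p = some r' →
      ¬ r'.IsIntro ∧ ¬ r'.IsBotC := by
    rintro p r' ⟨q, rfl, r, hr, hR⟩ hr'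
    exact (hD.edge hr hr').elim hR rfl
  rintro ⟨hl, p, hp, ⟨h1, h2⟩ | ⟨⟨r', hr', hb⟩, h | ⟨q, rfl, r, hr, hR⟩⟩⟩
  · rcases hl.last_cases hp with rfl | ⟨r', hr', h⟩ | ⟨r', hr', h⟩
    · obtain ⟨r', hr', h⟩ := h2 rfl
      exact (bad p r' h1 hr').1 h
    · refine (bad p r' h1 hr').1 ?_
      cases r' <;> first | exact h.elim | trivial
    · exact (bad p r' h1 hr').2 h
  · exact (bad p r' h hr').2 hb
  · exact ((hD.edge hr hr').ad hR rfl).1 hb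

/-- In the first kind a formula `t = t` would be the minor premise of `eqI`, which is `⊥`. In the
second kind the segment shrinks to a single assumption labelled `K + 1`, and `Edge.ad` forbids
inferring `∃! t` from it. -/
theorem Good.not_isMaxEqSegment (hD : D.Good K) (l : List Pos) : ¬ D.IsMaxEqSegment l := by
  rintro ⟨hl, ⟨t, h1, ⟨p, hp, q, rfl, r, hr, hR⟩, -⟩ |
    ⟨a, t, h1, ⟨p, q, hp, hd, r, hr, i, C, rfl⟩, p', hp', hA⟩⟩
  · have := h1 _ hp
    obtain ⟨r', hr', h2⟩ := Option.map_eq_some_iff.1 this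
    have h3 := (hD.edge hr hr').eqI hR rfl
    rw [h2] at h3
    cases h3
  · have hs := hl.eq_singleton_of_premiseOf_ad hD (fun r h => h.1) hp' hA
    subst hs
    simp only [List.head?_cons, Option.some.injEq] at hp
    subst hp
    obtain ⟨j, A, hj, ⟨n, s, r, -, hr2, hd⟩, -⟩ := hd
    rw [hr] at hr2
    cases hr2
    have hi := ((hD.ruleAt hr).eqI _ _ _ _ rfl).1
    subst hi
    match n, hd with
    | 1, hd =>
      simp only [Rule.disch, Set.mem_singleton_iff, Prod.mk.injEq] at hd
      obtain ⟨rfl, rfl⟩ := hd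
      obtain ⟨q', rfl, r', hr', hA1, hA2⟩ := hA
      exact ((hD.edge hr' hj).ad hA1 rfl).2.2.2 a t rfl hA2

theorem Good.not_isMaxExSegment (hD : D.Good K) (l : List Pos) : ¬ D.IsMaxExSegment l := by
  rintro ⟨-, t, -, -, p, -, q, rfl, r, hr, h1, h2⟩
  cases r <;> try exact h1.elim
  have := ((hD.ruleAt hr).eqI _ _ _ _ rfl).2
  subst this
  cases h2

/-- Only the last segment matters. It starts with the conclusion of `eqE`; above a denotation rule
it is a single formula, excluded by `Edge.ad`, and an existence formula is excluded by `NodeOk.eqE`.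
-/
theorem Good.not_isMaxEqESegment (hD : D.Good K) (L : List (List Pos)) :
    ¬ D.IsMaxEqESegment L := by
  rintro ⟨⟨h1, -, -, l, hl, ⟨p, hp, r, hr, hR⟩, -⟩, ⟨l', p', hl', hp', hA⟩ | h⟩
  · rw [hl] at hl'
    cases hl'
    have hs := (h1 l (List.mem_of_getLast? hl)).eq_singleton_of_premiseOf_ad hD
      (fun r h => h) hp' hA
    subst hs
    simp only [List.head?_cons, Option.some.injEq] at hp
    subst hp
    obtain ⟨q, rfl, r', hr', hA⟩ := hA
    exact ((hD.edge hr' hr).ad hA rfl).2.1 hR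
  · obtain ⟨t, ht⟩ := h l (List.mem_of_getLast? hl) p (List.mem_of_head? hp)
    rw [Ded.fmlAt, hr] at ht
    simp only [Option.map_some, Option.some.injEq] at ht
    exact ((hD.ruleAt hr).eqE hR).2 t ht

theorem Good.normal (hD : D.Good K) : D.Normal := by
  refine ⟨hD.not_isMaxIESegment, hD.not_isMaxEqSegment, hD.not_isMaxExSegment,
    hD.not_isMaxEqESegment, ?_⟩
  rintro p ⟨r, hr, hv⟩
  refine ((hD.ruleAt hr).eqE ?_).1 hv
  cases r <;> first | exact hv.elim | trivial

end Ded

section Derivability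

/-! ### Derivability by good deductions -/

/-- `A` has a correct and good deduction from assumption classes in `Γ` that satisfies `P`. -/
def Der (K : ℕ) (P : Ded S → Prop) (Γ : Set (ℕ × Fml S 0)) (A : Fml S 0) : Prop :=
  ∃ D : Ded S, D.Correct ∧ D.concl = A ∧ D.openAsm ⊆ Γ ∧ D.Good K ∧ P D

/-- The deduction is not an assumption with the label reserved for `botC`. -/
def NotCont (K : ℕ) (D : Ded S) : Prop := ∀ A, D.rule ≠ .asm K A

/-- The deduction is an unreserved assumption or ends with an elimination. -/
def Neutral (K : ℕ) (D : Ded S) : Prop :=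
  D.rule.IsElim ∨ ∃ i A, D.rule = .asm i A ∧ i ≠ K ∧ i ≠ K + 1

/-- The conclusion may serve as major premise of an elimination. -/
def Major (K : ℕ) (D : Ded S) : Prop := Neutral K D ∨ D.rule.IsEqE

/-- Such a deduction fits every premise except the major premise of an elimination, the premise of a
denotation rule, and the minor premise of `eqI` when its conclusion is not `⊥`. -/
abbrev Nf (K : ℕ) (Γ : Set (ℕ × Fml S 0)) (A : Fml S 0) : Prop := Der K (NotCont K) Γ A

abbrev Ne (K : ℕ) (Γ : Set (ℕ × Fml S 0)) (A : Fml S 0) : Prop := Der K (Neutral K) Γ A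

variable {K : ℕ} {Γ Γ' : Set (ℕ × Fml S 0)} {A B C : Fml S 0} {P Q : Ded S → Prop}

theorem Der.imp (h : Der K P Γ A) (hΓ : Γ ⊆ Γ') (hPQ : ∀ D, D.concl = A → P D → Q D) :
    Der K Q Γ' A :=
  let ⟨D, h1, h2, h3, h4, h5⟩ := h
  ⟨D, h1, h2, h3.trans hΓ, h4, hPQ D h2 h5⟩

theorem Der.mono (h : Der K P Γ A) (hΓ : Γ ⊆ Γ') : Der K P Γ' A := h.imp hΓ fun _ _ h => h

theorem Neutral.notCont {D : Ded S} (h : Neutral K D) : NotCont K D := by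
  rintro A hA
  rcases h with h | ⟨i, B, h, h1, -⟩
  · rw [hA] at h; exact h
  · rw [hA] at h; cases h; exact h1 rfl

theorem Major.notCont {D : Ded S} (h : Major K D) : NotCont K D := by
  rcases h with h | h
  · exact h.notCont
  · rintro A hA
    rw [hA] at h; exact h

theorem Ne.nf (h : Ne K Γ A) : Nf K Γ A := h.imp subset_rfl fun _ _ => Neutral.notCont

theorem Ne.major (h : Ne K Γ A) : Der K (Major K) Γ A := h.imp subset_rfl fun _ _ => .inl

/-- Composition of deductions by a rule instance. -/
theorem Der.node (r : Rule S) (Q : Fin r.prems.length → Ded S → Prop) (hok : r.Ok)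
    (hn : r.NodeOk K)
    (h : ∀ n : Fin r.prems.length,
      Der K (fun D => r.Edge K n D.rule ∧ Q n D) (Γ ∪ r.disch n) (r.prems.get n))
    (heig : ∀ n a, r.eigen n = some a → ∀ c ∈ Γ, ¬ c.2.HasPar a)
    (hasm : ∀ i A, r = .asm i A → (i, A) ∈ Γ)
    (hbot : ∀ ds : Fin r.prems.length → Ded S, (∀ n, Q n (ds n)) → ∀ i A, r = .botC i A →
      A.IsPrime ∨ ∃ n, (i, A.neg) ∈ (ds n).openAsm)
    (hP : ∀ ds : Fin r.prems.length → Ded S, (∀ n, Q n (ds n)) → P (.node r ds)) :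
    Der K P Γ r.concl := by
  choose ds h1 h2 h3 h4 h5 using h
  refine ⟨.node r ds, ?_, rfl, ?_, ⟨hn, fun n => ⟨(h5 n).1, h4 n⟩⟩, hP ds fun n => (h5 n).2⟩
  · refine ⟨h1, h2, hok, fun n a ha c hc hd => ?_, hbot ds fun n => (h5 n).2⟩
    exact heig n a ha c ((h3 n hc).resolve_right hd)
  · simp only [Ded.openAsm, Set.union_subset_iff, Set.iUnion_subset_iff]
    refine ⟨fun c hc => hasm c.1 c.2 hc, fun n c hc => (h3 n hc.1).resolve_right hc.2⟩

theorem Rule.NodeOk.of_ne {r : Rule S} (h1 : ¬ r.IsBotC) (h2 : ¬ r.IsEqI) (h3 : ¬ r.IsEqE) :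
    r.NodeOk K :=
  ⟨by rintro i A rfl; exact (h1 trivial).elim, by rintro i a t C rfl; exact (h2 trivial).elim,
    fun h => (h3 h).elim⟩

theorem Rule.Edge.of_notCont {r : Rule S} {n : ℕ} {D : Ded S} (h : NotCont K D)
    (h1 : n = 0 → ¬ r.IsElim ∧ ¬ r.IsAD) (h2 : n = 1 → ¬ r.IsEqI) : r.Edge K n D.rule :=
  ⟨fun A hA => (h A hA).elim, fun h h' => ((h1 h').1 h).elim, fun h h' => ((h1 h').2 h).elim,
    fun h h' => (h2 h' h).elim⟩

theorem Rule.Edge.of_major {r : Rule S} {D : Ded S} (h : Major K D) (h1 : ¬ r.IsAD) :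
    r.Edge K 0 D.rule := by
  refine ⟨fun A hA => (h.notCont A hA).elim, fun _ _ => ?_, fun h => (h1 h).elim,
    fun _ h => (by cases h)⟩
  rcases h with (h | ⟨i, A, h, -⟩) | h
  · generalize D.rule = r' at h
    cases r' <;> first | exact h.elim | exact ⟨id, id⟩
  · rw [h]; exact ⟨id, id⟩
  · generalize D.rule = r' at h
    cases r' <;> first | exact h.elim | exact ⟨id, id⟩

/-- In contrast to `Major`, a neutral deduction does not end with `eqE` and is not an assumption
labelled `K + 1`, so it may also stand above denotation rules. -/
theorem Rule.Edge.of_neutral {r : Rule S} {D : Ded S} (h : Neutral K D) :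
    r.Edge K 0 D.rule := by
  refine ⟨fun A hA => (h.notCont A hA).elim, fun _ _ => ?_, fun _ _ => ?_,
    fun _ h => (by cases h)⟩
  all_goals
    rcases h with h | ⟨i, A, h, -, h'⟩
    · generalize D.rule = r' at h
      cases r' <;> first
        | exact h.elim
        | exact ⟨id, id⟩
        | exact ⟨id, id, id, fun _ _ h => (by cases h)⟩
    · rw [h]
      first
        | exact ⟨id, id⟩
        | exact ⟨id, id, id, fun _ _ h => by cases h; exact (h' rfl).elim⟩

-- Good deductions composed rule by rule

theorem Der.asm {i : ℕ} (h : (i, A) ∈ Γ) (hP : ∀ ds, P (.node (.asm i A) ds)) : Der K P Γ A :=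
  Der.node (.asm i A) (fun _ _ => True) trivial (.of_ne id id id) (fun n => n.elim0)
    (by rintro n a h; cases h) (by rintro _ _ h; cases h; exact h)
    (by rintro _ _ _ _ h; cases h) fun ds _ => hP ds

theorem Ne.asm {i : ℕ} (h : (i, A) ∈ Γ) (h1 : i ≠ K) (h2 : i ≠ K + 1) : Ne K Γ A :=
  Der.asm h fun _ => .inr ⟨i, A, rfl, h1, h2⟩

theorem Nf.asm {i : ℕ} (h : (i, A) ∈ Γ) (h1 : i ≠ K) : Nf K Γ A :=
  Der.asm h fun _ B hB => by cases hB; exact h1 rfl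

theorem Nf.impI {i : ℕ} (h : Nf K (insert (i, A) Γ) B) : Nf K Γ (.imp A B) := by
  refine Der.node (.impI i A B) (fun _ _ => True) trivial (.of_ne id id id) ?_
    (by rintro n a h; cases h) (by rintro _ _ h; cases h) (by rintro _ _ _ _ h; cases h)
    (by rintro _ _ _ h; cases h)
  rintro ⟨_ | n, hn⟩
  · exact h.imp (by simp [Rule.disch]) fun D _ hD => ⟨.of_notCont hD (fun _ => ⟨id, id⟩)
      (fun _ => id), trivial⟩
  · exact absurd hn (by simp [Rule.prems])

theorem Ne.impE (h1 : Der K (Major K) Γ (.imp A B)) (h2 : Nf K Γ A) : Ne K Γ B := by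
  refine Der.node (.impE A B) (fun _ _ => True) trivial (.of_ne id id id) ?_
    (by rintro n a h; cases h) (by rintro _ _ h; cases h) (by rintro _ _ _ _ h; cases h)
    (fun _ _ => .inl trivial)
  rintro ⟨_ | _ | n, hn⟩
  · exact h1.imp Set.subset_union_left fun D _ hD => ⟨.of_major hD id, trivial⟩
  · exact h2.imp Set.subset_union_left fun D _ hD => ⟨.of_notCont hD (fun h => by cases h)
      (fun _ => id), trivial⟩
  · exact absurd hn (by simp [Rule.prems])

/-- An assumption of `¬ A` with the label reserved for `botC` refutes `A`; it is used. -/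
theorem Der.refute (hA : (K, A.neg) ∈ Γ) (h : Nf K Γ A) :
    Der K (fun D => NotCont K D ∧ (K, A.neg) ∈ D.openAsm) Γ .bot := by
  refine Der.node (.impE A .bot) (fun n D => n.1 = 0 → (K, A.neg) ∈ D.openAsm) trivial
    (.of_ne id id id) ?_ (by rintro n a h; cases h) (by rintro _ _ h; cases h)
    (by rintro _ _ _ _ h; cases h) fun ds hds => ⟨fun _ h => (by cases h), ?_⟩
  · rintro ⟨_ | _ | n, hn⟩
    · refine Der.asm (i := K) (.inl hA) fun _ => ⟨⟨fun _ _ => ⟨trivial, rfl⟩,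
        fun _ _ => ⟨id, id⟩, fun h => h.elim, fun _ h => (by cases h)⟩, fun _ => .inl rfl⟩
    · exact h.imp Set.subset_union_left fun D _ hD => ⟨.of_notCont hD (fun h => by cases h)
        (fun _ => id), fun h => (by cases h)⟩
    · exact absurd hn (by simp [Rule.prems])
  · exact .inr (Set.mem_iUnion.2 ⟨⟨0, by simp [Rule.prems]⟩, hds _ rfl, fun h => h.elim⟩)

theorem Nf.refute (hA : (K, A.neg) ∈ Γ) (h : Nf K Γ A) : Nf K Γ .bot :=
  (Der.refute hA h).imp subset_rfl fun _ _ h => h.1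

/-- The extra property of the subdeduction is the proviso on vacuous discharge; it has to be tracked
because `openAsm` is otherwise bounded only from above. -/
theorem Nf.botC (hA : A.IsAtomic) (h : Der K (fun D => NotCont K D ∧
    (A.IsPrime ∨ (K, A.neg) ∈ D.openAsm)) (insert (K, A.neg) Γ) .bot) : Nf K Γ A := by
  refine Der.node (.botC K A) (fun _ D => A.IsPrime ∨ (K, A.neg) ∈ D.openAsm) hA
    ⟨(by rintro i B h; cases h; rfl), (by rintro _ _ _ _ h; cases h), fun h => h.elim⟩ ?_
    (by rintro n a h; cases h) (by rintro _ _ h; cases h)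
    (by rintro ds hds _ _ h; cases h; exact (hds ⟨0, by simp [Rule.prems]⟩).imp id fun h => ⟨_, h⟩)
    (by rintro _ _ _ h; cases h)
  rintro ⟨_ | n, hn⟩
  · exact h.imp (by simp [Rule.disch]) fun D _ hD => ⟨.of_notCont hD.1 (fun _ => ⟨id, id⟩)
      (fun _ => id), hD.2⟩
  · exact absurd hn (by simp [Rule.prems])

theorem Fml.IsPrime.isAtomic (h : A.IsPrime) : A.IsAtomic := by
  cases A <;> first | exact h.elim | trivial

theorem Nf.exfalso_prime (hA : A.IsPrime) (h : Nf K Γ .bot) : Nf K Γ A :=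
  Nf.botC hA.isAtomic (h.imp (Set.subset_insert _ _) fun _ _ h => ⟨h, .inl hA⟩)

/-- Classical reductio, if `A` follows from falsity. -/
theorem Nf.reductio (hA : A.IsAtomic) (h : Nf K (insert (K, A.neg) Γ) .bot)
    (hex : Nf K Γ .bot → Nf K Γ A) : Nf K Γ A := by
  obtain ⟨D, h1, h2, h3, h4, h5⟩ := h
  -- If the discharge would be vacuous, `⊥` is already derivable without `¬ A`. For `A` that is not
  -- prime, `hex` replaces the forbidden application of `botC`.
  by_cases hD : (K, A.neg) ∈ D.openAsm
  · exact Nf.botC hA ⟨D, h1, h2, h3, h4, h5, .inr hD⟩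
  · refine hex ⟨D, h1, h2, fun c hc => (h3 hc).resolve_left ?_, h4, h5⟩
    rintro rfl
    exact hD hc

theorem Nf.allI {i a : ℕ} {A : Fml S 1} (hA : ¬ A.HasPar a) (hΓ : ∀ c ∈ Γ, ¬ c.2.HasPar a)
    (h : Nf K (insert (i, .ex (.par a)) Γ) (A.inst (.par a))) : Nf K Γ (.all A) := by
  refine Der.node (.allI i a A) (fun _ _ => True) hA (.of_ne id id id) ?_
    (by rintro n b h; cases h; exact hΓ) (by rintro _ _ h; cases h)
    (by rintro _ _ _ _ h; cases h) (by rintro _ _ _ h; cases h)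
  rintro ⟨_ | n, hn⟩
  · exact h.imp (by simp [Rule.disch]) fun D _ hD => ⟨.of_notCont hD (fun _ => ⟨id, id⟩)
      (fun _ => id), trivial⟩
  · exact absurd hn (by simp [Rule.prems])

theorem Ne.allE {A : Fml S 1} {t : Tm S 0} (ht : t.IsAtomic) (h1 : Der K (Major K) Γ (.all A))
    (h2 : Nf K Γ (.ex t)) : Ne K Γ (A.inst t) := by
  refine Der.node (.allE A t) (fun _ _ => True) ht (.of_ne id id id) ?_
    (by rintro n a h; cases h) (by rintro _ _ h; cases h) (by rintro _ _ _ _ h; cases h)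
    (fun _ _ => .inl trivial)
  rintro ⟨_ | _ | n, hn⟩
  · exact h1.imp Set.subset_union_left fun D _ hD => ⟨.of_major hD id, trivial⟩
  · exact h2.imp Set.subset_union_left fun D _ hD => ⟨.of_notCont hD (fun h => by cases h)
      (fun _ => id), trivial⟩
  · exact absurd hn (by simp [Rule.prems])

/-- Identity introduction with conclusion `⊥`. -/
theorem Der.eqI {a : ℕ} {t : Tm S 0} (R : Ded S → Prop) (ht : ¬ t.HasPar a)
    (hΓ : ∀ c ∈ Γ, ¬ c.2.HasPar a) (h1 : Nf K Γ (.ex t))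
    (h2 : Der K (fun D => NotCont K D ∧ R D) (insert (K + 1, .eq (.par a) t) Γ) .bot)
    (hP : ∀ ds, R (ds ⟨1, by simp [Rule.prems]⟩) → P (.node (.eqI (K + 1) a t .bot) ds)) :
    Der K P Γ .bot := by
  refine Der.node (.eqI (K + 1) a t .bot) (fun n D => n.1 = 1 → R D) ⟨ht, id⟩
    ⟨(by rintro _ _ h; cases h), (by rintro _ _ _ _ h; cases h; exact ⟨rfl, rfl⟩), fun h => h.elim⟩ ?_
    ?_ (by rintro _ _ h; cases h) (by rintro _ _ _ _ h; cases h) fun ds hds => hP ds (hds _ rfl)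
  · rintro ⟨_ | _ | n, hn⟩
    · exact h1.imp Set.subset_union_left fun D _ hD => ⟨.of_notCont hD (fun _ => ⟨id, id⟩)
        (fun h => by cases h), fun h => (by cases h)⟩
    · refine h2.imp (by simp [Rule.disch]) fun D hD hR => ⟨⟨fun A hA => (hR.1 A hA).elim,
        fun _ h => (by cases h), fun _ h => (by cases h), fun _ _ => hD⟩, fun _ => hR.2⟩
    · exact absurd hn (by simp [Rule.prems])
  · rintro (_ | _ | n) b h
    · cases h
    · cases h; exact hΓ
    · cases h

theorem Nf.eqI {a : ℕ} {t : Tm S 0} (ht : ¬ t.HasPar a) (hΓ : ∀ c ∈ Γ, ¬ c.2.HasPar a)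
    (h1 : Nf K Γ (.ex t)) (h2 : Nf K (insert (K + 1, .eq (.par a) t) Γ) .bot) : Nf K Γ .bot :=
  Der.eqI (fun _ => True) ht hΓ h1 (h2.imp subset_rfl fun _ _ h => ⟨h, trivial⟩)
    fun _ _ _ h => by cases h

theorem Der.eqE {A : Fml S 1} {s t : Tm S 0} (hA : A.IsAtomic) (hne : A.inst s ≠ A.inst t)
    (hex : ∀ u, A.inst t ≠ .ex u) (h1 : Nf K Γ (.eq s t)) (h2 : Nf K Γ (A.inst s)) :
    Der K (Major K) Γ (A.inst t) := by
  refine Der.node (.eqE A s t) (fun _ _ => True) hA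
    ⟨(by rintro _ _ h; cases h), (by rintro _ _ _ _ h; cases h), fun _ => ⟨hne, hex⟩⟩ ?_
    (by rintro n a h; cases h) (by rintro _ _ h; cases h) (by rintro _ _ _ _ h; cases h)
    (fun _ _ => .inr trivial)
  rintro ⟨_ | _ | n, hn⟩
  · exact h1.imp Set.subset_union_left fun D _ hD => ⟨.of_notCont hD (fun _ => ⟨id, id⟩)
      (fun _ => id), trivial⟩
  · exact h2.imp Set.subset_union_left fun D _ hD => ⟨.of_notCont hD (fun h => by cases h)
      (fun _ => id), trivial⟩
  · exact absurd hn (by simp [Rule.prems])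

theorem Nf.eqE {A : Fml S 1} {s t : Tm S 0} (hA : A.IsAtomic) (hex : ∀ u, A.inst t ≠ .ex u)
    (h1 : Nf K Γ (.eq s t)) (h2 : Nf K Γ (A.inst s)) : Nf K Γ (A.inst t) := by
  by_cases hne : A.inst s = A.inst t
  · rwa [← hne]
  · exact (Der.eqE hA hne hex h1 h2).imp subset_rfl fun _ _ => Major.notCont

/-- The rule of atomic denotation, applied to a premise with suitable last rule. -/
theorem Nf.ad {A : Fml S 0} {t : Tm S 0} (hA : A.HasArg t) (hF : ∀ F, A ≠ .eq (.iota F) t)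
    (h : Der K (fun D => NotCont K D ∧ ¬ D.rule.IsBotC ∧ ¬ D.rule.IsEqE ∧ ¬ D.rule.IsEqI ∧
      ∀ a s, D.rule = .asm (K + 1) (.eq (.par a) s) → t ≠ s) Γ A) : Nf K Γ (.ex t) := by
  refine Der.node (.ad A t) (fun _ _ => True) ⟨hA, hF⟩ (.of_ne id id id) ?_
    (by rintro n a h; cases h) (by rintro _ _ h; cases h) (by rintro _ _ _ _ h; cases h)
    (by rintro _ _ _ h; cases h)
  rintro ⟨_ | n, hn⟩
  · refine h.imp Set.subset_union_left fun D _ hD => ⟨⟨fun B hB => (hD.1 B hB).elim, fun h => h.elim,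
      fun _ _ => ⟨hD.2.1, hD.2.2.1, hD.2.2.2.1, fun a s hs h => hD.2.2.2.2 a s hs ?_⟩,
      fun h => h.elim⟩, trivial⟩
    cases h; rfl
  · exact absurd hn (by simp [Rule.prems])

/-- The instances that count as `iotaE₃` are eliminations as well; neutrality meets both conditions
on the premise. -/
theorem Ne.ad {t : Tm S 0} (hA : A.HasArg t) (h : Ne K Γ A) : Nf K Γ (.ex t) := by
  by_cases hF : ∃ F, A = .eq (.iota F) t
  · obtain ⟨F, rfl⟩ := hF
    refine Der.node (.iotaE₃ F t) (fun _ _ => True) trivial (.of_ne id id id) ?_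
      (by rintro n a h; cases h) (by rintro _ _ h; cases h) (by rintro _ _ _ _ h; cases h)
      (by rintro _ _ _ h; cases h)
    rintro ⟨_ | n, hn⟩
    · exact h.imp Set.subset_union_left fun D _ hD => ⟨.of_neutral hD, trivial⟩
    · exact absurd hn (by simp [Rule.prems])
  · refine Nf.ad hA (fun F h => hF ⟨F, h⟩) (h.imp subset_rfl fun D _ hD => ⟨hD.notCont, ?_⟩)
    have := (Rule.Edge.of_neutral (r := .ad A t) hD).ad trivial rfl
    exact ⟨this.1, this.2.1, this.2.2.1, fun a s h e => this.2.2.2 a s h (by rw [e]; rfl)⟩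

theorem Ne.ad_left {s t : Tm S 0} (h : Ne K Γ (.eq s t)) : Nf K Γ (.ex s) :=
  Ne.ad (A := .eq s t) (.inl rfl) h

theorem Ne.ad_right {s t : Tm S 0} (h : Ne K Γ (.eq s t)) : Nf K Γ (.ex t) :=
  Ne.ad (A := .eq s t) (.inr rfl) h

theorem Ne.ad_pred {R : S.Pred} {ts : Fin (S.ar R) → Tm S 0} (h : Ne K Γ (.pred R ts))
    (k : Fin (S.ar R)) : Nf K Γ (.ex (ts k)) :=
  Ne.ad (A := .pred R ts) ⟨k, rfl⟩ h

/-- Atomic denotation of the restricted parameter of an identity introduction. -/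
theorem Nf.ex_par {a : ℕ} {t : Tm S 0} (h : (K + 1, .eq (.par a) t) ∈ Γ) (ht : ¬ t.HasPar a) :
    Nf K Γ (.ex (.par a)) := by
  refine Nf.ad (A := .eq (.par a) t) (.inl rfl) (fun F h => by cases h) (Der.asm h fun ds =>
    ⟨fun B hB => ?_, id, id, id, fun b s hs e => ?_⟩)
  · cases hB
  · cases hs
    -- Only the existence of the right-hand term is barred here; that term is not `a`, since `a`
    -- does not occur in it.
    subst e
    exact ht rfl

/-- The last rule is remembered because an introduction by `iotaI`, unlike an arbitrary `Nf`
deduction, may be the premise of `ad`. -/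
theorem Der.iotaI {i j k a : ℕ} {F : Fml S 1} {t : Tm S 0} (ht : t.IsAtomic) (hF : ¬ F.HasPar a)
    (hta : ¬ t.HasPar a) (hΓ : ∀ c ∈ Γ, ¬ c.2.HasPar a) (h1 : Nf K Γ (.ex t))
    (h2 : Nf K (insert (i, .eq (.par a) t) Γ) (F.inst (.par a)))
    (h3 : Nf K (insert (j, F.inst (.par a)) (insert (k, .ex (.par a)) Γ)) (.eq (.par a) t)) :
    Der K (fun D => ∃ i j k a, D.rule = .iotaI i j k a F t) Γ (.eq (.iota F) t) := by
  refine Der.node (.iotaI i j k a F t) (fun _ _ => True) ⟨ht, hF, hta⟩ (.of_ne id id id) ?_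
    (by rintro n b h; cases h; exact hΓ) (by rintro _ _ h; cases h)
    (by rintro _ _ _ _ h; cases h) (fun _ _ => ⟨i, j, k, a, rfl⟩)
  rintro ⟨_ | _ | _ | n, hn⟩
  · exact h1.imp Set.subset_union_left fun D _ hD => ⟨.of_notCont hD (fun _ => ⟨id, id⟩)
      (fun _ => id), trivial⟩
  · exact h2.imp (by simp [Rule.disch]) fun D _ hD => ⟨.of_notCont hD (fun h => by cases h)
      (fun _ => id), trivial⟩
  · refine h3.imp ?_ fun D _ hD => ⟨.of_notCont hD (fun h => by cases h)
      (fun _ => id), trivial⟩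
    simp only [Rule.disch]
    rintro c (rfl | rfl | h) <;> simp [*]
  · exact absurd hn (by simp [Rule.prems])

theorem Ne.iotaE₁ {F : Fml S 1} {t u : Tm S 0} (ht : t.IsAtomic) (hu : u.IsAtomic)
    (h1 : Der K (Major K) Γ (.eq (.iota F) t)) (h2 : Nf K Γ (.eq u t)) : Ne K Γ (F.inst u) := by
  refine Der.node (.iotaE₁ F t u) (fun _ _ => True) ⟨ht, hu⟩ (.of_ne id id id) ?_
    (by rintro n a h; cases h) (by rintro _ _ h; cases h) (by rintro _ _ _ _ h; cases h)
    (fun _ _ => .inl trivial)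
  rintro ⟨_ | _ | n, hn⟩
  · exact h1.imp Set.subset_union_left fun D _ hD => ⟨.of_major hD id, trivial⟩
  · exact h2.imp Set.subset_union_left fun D _ hD => ⟨.of_notCont hD (fun h => by cases h)
      (fun _ => id), trivial⟩
  · exact absurd hn (by simp [Rule.prems])

theorem Ne.iotaE₂ {F : Fml S 1} {t u : Tm S 0} (ht : t.IsAtomic) (hu : u.IsAtomic)
    (h1 : Der K (Major K) Γ (.eq (.iota F) t)) (h2 : Nf K Γ (F.inst u)) (h3 : Nf K Γ (.ex u)) :
    Ne K Γ (.eq u t) := by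
  refine Der.node (.iotaE₂ F t u) (fun _ _ => True) ⟨ht, hu⟩ (.of_ne id id id) ?_
    (by rintro n a h; cases h) (by rintro _ _ h; cases h) (by rintro _ _ _ _ h; cases h)
    (fun _ _ => .inl trivial)
  rintro ⟨_ | _ | _ | n, hn⟩
  · exact h1.imp Set.subset_union_left fun D _ hD => ⟨.of_major hD id, trivial⟩
  · exact h2.imp Set.subset_union_left fun D _ hD => ⟨.of_notCont hD (fun h => by cases h)
      (fun _ => id), trivial⟩
  · exact h3.imp Set.subset_union_left fun D _ hD => ⟨.of_notCont hD (fun h => by cases h)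
      (fun _ => id), trivial⟩
  · exact absurd hn (by simp [Rule.prems])

/-! ### Derived rules for identity -/

/-- Replacement in the left term of an identity. -/
theorem Nf.eq_replace_left {s t u : Tm S 0} (h1 : Nf K Γ (.eq s t)) (h2 : Nf K Γ (.eq s u)) :
    Nf K Γ (.eq t u) := by
  have := Nf.eqE (K := K) (Γ := Γ) (A := .eq (.bv 0) u.wk) (s := s) (t := t) trivial
    (fun _ h => by cases h) h1 (by simpa [Fml.inst, Fml.subst, Tm.subst] using h2)
  simpa [Fml.inst, Fml.subst, Tm.subst] using this

/-- Replacement in the right term of an identity. -/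
theorem Nf.eq_replace_right {s t u : Tm S 0} (h1 : Nf K Γ (.eq s t)) (h2 : Nf K Γ (.eq u s)) :
    Nf K Γ (.eq u t) := by
  have := Nf.eqE (K := K) (Γ := Γ) (A := .eq u.wk (.bv 0)) (s := s) (t := t) trivial
    (fun _ h => by cases h) h1 (by simpa [Fml.inst, Fml.subst, Tm.subst] using h2)
  simpa [Fml.inst, Fml.subst, Tm.subst] using this

/-- Concluding `t = t` directly by `eqI` is not allowed in good deductions. Instead `¬ t = t` is
assumed, `a = t` is used to replace `a` in itself, and the resulting `⊥` passes through `eqI` before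
reductio. -/
theorem Nf.refl (hΓ : Γ.Finite) {t : Tm S 0} (h : Nf K Γ (.ex t)) : Nf K Γ (.eq t t) := by
  obtain ⟨a, h1, h2, -⟩ := exists_fresh hΓ (Fml.ex t) (Fml.ex t)
  refine Nf.botC trivial (Der.eqI (a := a) (fun D => (K, (Fml.eq t t).neg) ∈ D.openAsm) h2 ?_
    (h.mono (Set.subset_insert _ _)) (Der.refute (by simp) ?_)
    fun ds hds => ⟨fun _ h => (by cases h), .inr ?_⟩)
  · rintro c (rfl | hc)
    · rintro ((h | h) | h)
      exacts [h2 h, h2 h, h]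
    · exact h1 c hc
  · have : Nf K (insert (K + 1, .eq (.par a) t) (insert (K, (Fml.eq t t).neg) Γ))
        (.eq (.par a) t) := Nf.asm (.inl rfl) (by simp)
    exact this.eq_replace_left this
  -- The assumption `¬ t = t` stays open below `eqI`, which discharges label `K + 1` only; hence the
  -- reductio is not vacuous, as needed when `t` is a description.
  · exact .inr (Set.mem_iUnion.2 ⟨⟨1, by simp [Rule.prems]⟩, hds, by simp [Rule.disch]⟩)

theorem Nf.symm (hΓ : Γ.Finite) {s t : Tm S 0} (h : Nf K Γ (.eq s t)) (hs : Nf K Γ (.ex s)) :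
    Nf K Γ (.eq t s) :=
  h.eq_replace_left (hs.refl hΓ)

/-- Arguments are replaced one at a time, by induction on the set of places already treated. -/
theorem Nf.pred_replace {R : S.Pred} {s t : Fin (S.ar R) → Tm S 0}
    (h : ∀ k, Nf K Γ (.eq (s k) (t k))) (hs : Nf K Γ (.pred R s)) : Nf K Γ (.pred R t) := by
  classical
  suffices H : ∀ T : Finset (Fin (S.ar R)),
      Nf K Γ (.pred R fun k => if k ∈ T then t k else s k) by simpa using H Finset.univ
  intro T
  induction T using Finset.induction_on with
  | empty => simpa using hs
  | insert k T hk ih =>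
    have := Nf.eqE (K := K) (Γ := Γ) (s := s k) (t := t k)
      (A := .pred R fun j => if j = k then .bv 0 else (if j ∈ T then t j else s j).wk) trivial
      (fun _ h => by cases h) (h k) ?_
    · convert this using 1
      simp only [Fml.inst, Fml.subst]
      congr 1
      funext j
      by_cases hj : j = k
      · simp [hj, Tm.subst]
      · simp [hj]
    · convert ih using 1
      simp only [Fml.inst, Fml.subst]
      congr 1
      funext j
      by_cases hj : j = k
      · simp [hj, hk, Tm.subst]
      · simp [hj]

/-- Falsity may be derived with the help of names for finitely many existing objects. -/
theorem Nf.bot_of_names {n : ℕ} : ∀ {Γ : Set (ℕ × Fml S 0)}, Γ.Finite → ∀ s : Fin n → Tm S 0,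
    (∀ k, Nf K Γ (.ex (s k))) →
    (∀ Γ', Γ'.Finite → Γ ⊆ Γ' → ∀ a : Fin n → ℕ,
      (∀ k, (K + 1, .eq (.par (a k)) (s k)) ∈ Γ' ∧ ¬ (s k).HasPar (a k)) → Nf K Γ' .bot) →
    Nf K Γ .bot := by
  induction n with
  | zero => exact fun hΓ s _ H => H _ hΓ subset_rfl Fin.elim0 fun k => k.elim0
  | succ n ih =>
    intro Γ hΓ s hs H
    obtain ⟨a, h1, h2, -⟩ := exists_fresh hΓ (Fml.ex (s 0)) (Fml.ex (s 0))
    refine Nf.eqI h2 h1 (hs 0) ?_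
    refine ih (hΓ.insert _) (fun k => s k.succ)
      (fun k => (hs k.succ).mono (Set.subset_insert _ _)) fun Γ' hΓ' hsub b hb => ?_
    refine H Γ' hΓ' ((Set.subset_insert _ _).trans hsub) (push a b) fun k => ?_
    refine Fin.cases ⟨hsub (.inl rfl), h2⟩ (fun k => hb k) k

end Derivability

section Forcing

/-! ### Forcing -/

/-- Finite sets of assumption classes. -/
abbrev World (S : Sig.{u, v}) := {Γ : Set (ℕ × Fml S 0) // Γ.Finite}

/-- The atomic terms of the language. -/
abbrev Atom (S : Sig.{u, v}) := {t : Tm S 0 // t.IsAtomic}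

/-- Values of terms: `v Γ c` says that the term denotes the same object as `c` does, at `Γ`. -/
abbrev Val (S : Sig.{u, v}) := World S → Atom S → Prop

/-- Extension of a world by an assumption class. -/
def World.ins (c : ℕ × Fml S 0) (Γ : World S) : World S := ⟨insert c Γ.1, Γ.2.insert c⟩

theorem World.le_ins (c : ℕ × Fml S 0) (Γ : World S) : Γ ≤ Γ.ins c := Set.subset_insert _ _

/-- The atomic term given by a parameter. -/
def Atom.par (a : ℕ) : Atom S := ⟨.par a, trivial⟩

/-- The closure of a condition on worlds under classical reductio. -/
def J (K : ℕ) (P : World S → Prop) (Γ : World S) : Prop :=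
  ∀ Γ' ≥ Γ, (∀ Γ'' ≥ Γ', P Γ'' → Nf K Γ''.1 .bot) → Nf K Γ'.1 .bot

/-- Identity of existing atomic terms. -/
def EqAt (K : ℕ) (Γ : World S) (s t : Atom S) : Prop :=
  Nf K Γ.1 (.eq s.1 t.1) ∧ Nf K Γ.1 (.ex s.1) ∧ Nf K Γ.1 (.ex t.1)

mutual
/-- The value of a term. -/
def Tm.den (K : ℕ) (η : ℕ → Val S) : {n : ℕ} → Tm S n → (Fin n → Val S) → Val S
  | _, .bv k, ρ => ρ k
  | _, .par a, _ => η a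
  | _, .con c, _ => fun Γ d => EqAt K Γ ⟨.con c, trivial⟩ d
  | _, .iota F, ρ => fun Γ c => Nf K Γ.1 (.ex c.1) ∧ ∀ Γ' ≥ Γ, ∀ u : Atom S,
      (EqAt K Γ' u c → F.force K η (push (fun Γ d => EqAt K Γ u d) ρ) Γ') ∧
      (F.force K η (push (fun Γ d => EqAt K Γ u d) ρ) Γ' → Nf K Γ'.1 (.ex u.1) → EqAt K Γ' u c)
/-- The worlds that force a formula. -/
def Fml.force (K : ℕ) (η : ℕ → Val S) : {n : ℕ} → Fml S n → (Fin n → Val S) → World S → Prop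
  | _, .bot, _ => fun Γ => Nf K Γ.1 .bot
  | _, .pred R ts, ρ => J K fun Γ => ∃ c : Fin (S.ar R) → Atom S,
      (∀ k, (ts k).den K η ρ Γ (c k)) ∧ Nf K Γ.1 (.pred R fun k => (c k).1)
  | _, .ex t, ρ => J K fun Γ => ∃ c, t.den K η ρ Γ c
  | _, .eq s t, ρ => J K fun Γ => ∃ c, s.den K η ρ Γ c ∧ t.den K η ρ Γ c
  | _, .imp A B, ρ => fun Γ => ∀ Γ' ≥ Γ, A.force K η ρ Γ' → B.force K η ρ Γ'
  | _, .all A, ρ => fun Γ => ∀ Γ' ≥ Γ, ∀ u : Atom S, Nf K Γ'.1 (.ex u.1) →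
      A.force K η (push (fun Γ d => EqAt K Γ u d) ρ) Γ'
end

/-- The value of an atomic term. -/
def Atom.val (K : ℕ) (c : Atom S) : Val S := fun Γ d => EqAt K Γ c d

-- The closure operator and identity of atomic terms

variable {K : ℕ} {η : ℕ → Val S} {Γ Γ' : World S} {P Q : World S → Prop}

theorem J.mono (h : J K P Γ) (hΓ : Γ ≤ Γ') : J K P Γ' := fun _ h1 h2 => h _ (hΓ.trans h1) h2

theorem J.intro (h : ∀ Γ' ≥ Γ, P Γ') : J K P Γ := fun _ h1 h2 => h2 _ le_rfl (h _ h1)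

theorem J.bind (h : J K P Γ) (hPQ : ∀ Γ' ≥ Γ, P Γ' → J K Q Γ') : J K Q Γ := fun _ h1 h2 =>
  h _ h1 fun _ h3 h4 => hPQ _ (h1.trans h3) h4 _ le_rfl fun _ h5 h6 => h2 _ (h3.trans h5) h6

theorem J.of_bot (h : Nf K Γ.1 .bot) : J K P Γ := fun _ h1 _ => h.mono h1

/-- Atomic formulas that follow from falsity are closed under classical reductio. -/
theorem J.nf {A : Fml S 0} (hA : A.IsAtomic) (hex : Nf K Γ.1 .bot → Nf K Γ.1 A)
    (h : J K (fun Γ => Nf K Γ.1 A) Γ) : Nf K Γ.1 A :=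
  Nf.reductio hA (h (Γ.ins (K, A.neg)) (World.le_ins _ _) fun _ h1 h2 =>
    Nf.refute (h1 (.inl rfl)) h2) hex

theorem J.nf_prime {A : Fml S 0} (hA : A.IsPrime) (h : J K (fun Γ => Nf K Γ.1 A) Γ) :
    Nf K Γ.1 A :=
  J.nf hA.isAtomic (Nf.exfalso_prime hA) h

theorem J.imp (h : J K P Γ) (hPQ : ∀ Γ' ≥ Γ, P Γ' → Q Γ') : J K Q Γ :=
  fun _ h1 h2 => h _ h1 fun _ h3 h4 => h2 _ h3 (hPQ _ (h1.trans h3) h4)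

theorem Atom.prime_ex (c : Atom S) : (Fml.ex c.1).IsPrime := c.2

theorem Atom.prime_eq (c d : Atom S) : (Fml.eq c.1 d.1).IsPrime := ⟨c.2, d.2⟩

namespace EqAt

variable {c d e : Atom S}

theorem mono (h : EqAt K Γ c d) (hΓ : Γ ≤ Γ') : EqAt K Γ' c d :=
  ⟨h.1.mono hΓ, h.2.1.mono hΓ, h.2.2.mono hΓ⟩

theorem refl (h : Nf K Γ.1 (.ex c.1)) : EqAt K Γ c c := ⟨h.refl Γ.2, h, h⟩

theorem symm (h : EqAt K Γ c d) : EqAt K Γ d c := ⟨h.1.symm Γ.2 h.2.1, h.2.2, h.2.1⟩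

theorem trans (h : EqAt K Γ c d) (h' : EqAt K Γ d e) : EqAt K Γ c e :=
  ⟨h'.1.eq_replace_right h.1, h.2.1, h'.2.2⟩

/-- Both terms are atomic, so the three formulas are prime and vacuous reductio is available. -/
theorem of_bot (h : Nf K Γ.1 .bot) : EqAt K Γ c d :=
  ⟨h.exfalso_prime (c.prime_eq d), h.exfalso_prime c.prime_ex, h.exfalso_prime d.prime_ex⟩

theorem of_J (h : J K (fun Γ => EqAt K Γ c d) Γ) : EqAt K Γ c d :=
  ⟨J.nf_prime (c.prime_eq d) (h.imp fun _ _ h => h.1),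
    J.nf_prime c.prime_ex (h.imp fun _ _ h => h.2.1),
    J.nf_prime d.prime_ex (h.imp fun _ _ h => h.2.2)⟩

end EqAt

theorem Fml.force_mono : ∀ {n : ℕ} (A : Fml S n) {ρ : Fin n → Val S} {Γ Γ' : World S},
    A.force K η ρ Γ → Γ ≤ Γ' → A.force K η ρ Γ'
  | _, .bot, _, _, _, h, hΓ => Der.mono h hΓ
  | _, .pred _ _, _, _, _, h, hΓ => J.mono h hΓ
  | _, .ex _, _, _, _, h, hΓ => J.mono h hΓ
  | _, .eq _ _, _, _, _, h, hΓ => J.mono h hΓ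
  | _, .imp _ _, _, _, _, h, hΓ => fun _ h1 => h _ (hΓ.trans h1)
  | _, .all _, _, _, _, h, hΓ => fun _ h1 => h _ (hΓ.trans h1)

/-- Forcing is closed under classical reductio. -/
theorem Fml.force_of_J : ∀ {n : ℕ} (A : Fml S n) {ρ : Fin n → Val S} {Γ : World S},
    J K (A.force K η ρ) Γ → A.force K η ρ Γ
  | _, .bot, _, _, h => h _ le_rfl fun _ _ h => h
  | _, .pred _ _, _, _, h => h.bind fun _ _ h => h
  | _, .ex _, _, _, h => h.bind fun _ _ h => h
  | _, .eq _ _, _, _, h => h.bind fun _ _ h => h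
  | _, .imp A B, _, _, h => fun _ h1 h2 => B.force_of_J
      ((h.mono h1).imp fun _ h3 h4 => h4 _ le_rfl (A.force_mono h2 h3))
  | _, .all A, _, _, h => fun _ h1 _ h2 => A.force_of_J
      ((h.mono h1).imp fun _ h3 h4 => h4 _ le_rfl _ (h2.mono h3))

theorem Fml.force_bind {n : ℕ} {A : Fml S n} {ρ : Fin n → Val S} (h : J K P Γ)
    (hP : ∀ Γ' ≥ Γ, P Γ' → A.force K η ρ Γ') : A.force K η ρ Γ :=
  A.force_of_J (h.imp hP)

theorem Fml.force_of_bot {n : ℕ} {A : Fml S n} {ρ : Fin n → Val S} (h : Nf K Γ.1 .bot) :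
    A.force K η ρ Γ :=
  A.force_of_J (J.of_bot h)

/-- Agreement of values from a world on. -/
def Val.Agree (Γ : World S) (v w : Val S) : Prop := ∀ Γ' ≥ Γ, ∀ c, v Γ' c ↔ w Γ' c

theorem Val.Agree.rfl {v : Val S} : v.Agree Γ v := fun _ _ _ => Iff.rfl

theorem Val.Agree.mono {v w : Val S} (h : v.Agree Γ w) (hΓ : Γ ≤ Γ') : v.Agree Γ' w :=
  fun _ h1 => h _ (hΓ.trans h1)

theorem J.congr (h : ∀ Γ' ≥ Γ, (P Γ' ↔ Q Γ')) : J K P Γ ↔ J K Q Γ :=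
  ⟨fun h1 => h1.imp fun _ h2 => (h _ h2).1, fun h1 => h1.imp fun _ h2 => (h _ h2).2⟩

theorem push_agree {n : ℕ} {v : Val S} {ρ ρ' : Fin n → Val S}
    (h : ∀ k, (ρ k).Agree Γ (ρ' k)) (k : Fin (n + 1)) : (push v ρ k).Agree Γ (push v ρ' k) :=
  Fin.cases (motive := fun k => (push v ρ k).Agree Γ (push v ρ' k)) .rfl h k

mutual
/-- Values depend only on the values of the parameters that occur and of the variables. -/
theorem Tm.den_congr {η η' : ℕ → Val S} : ∀ {n : ℕ} (t : Tm S n) {ρ ρ' : Fin n → Val S}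
    {Γ : World S}, (∀ a, t.HasPar a → (η a).Agree Γ (η' a)) → (∀ k, (ρ k).Agree Γ (ρ' k)) →
    Val.Agree Γ (t.den K η ρ) (t.den K η' ρ')
  | _, .bv k, _, _, _, _, h => h k
  | _, .par a, _, _, _, h, _ => h a rfl
  | _, .con _, _, _, _, _, _ => .rfl
  | _, .iota F, _, _, _, h, h' => fun Γ' h1 c => by
    refine and_congr_right fun _ => forall₂_congr fun Γ₂ h2 => forall_congr' fun u => ?_
    have := Fml.force_congr F (ρ := push (fun Γ d => EqAt K Γ u d) _) (fun a ha => (h a ha).mono h1)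
      (push_agree fun k => (h' k).mono h1) Γ₂ h2
    rw [this]
theorem Fml.force_congr {η η' : ℕ → Val S} : ∀ {n : ℕ} (A : Fml S n) {ρ ρ' : Fin n → Val S}
    {Γ : World S}, (∀ a, A.HasPar a → (η a).Agree Γ (η' a)) → (∀ k, (ρ k).Agree Γ (ρ' k)) →
    ∀ Γ' ≥ Γ, (A.force K η ρ Γ' ↔ A.force K η' ρ' Γ')
  | _, .bot, _, _, _, _, _ => fun _ _ => Iff.rfl
  | _, .pred _ ts, _, _, _, h, h' => fun _ h1 => J.congr fun Γ₂ h2 =>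
    exists_congr fun c => and_congr_left fun _ => forall_congr' fun k =>
      Tm.den_congr (ts k) (fun a ha => h a ⟨k, ha⟩) h' Γ₂ (h1.trans h2) (c k)
  | _, .ex t, _, _, _, h, h' => fun _ h1 => J.congr fun Γ₂ h2 =>
    exists_congr fun c => Tm.den_congr t h h' Γ₂ (h1.trans h2) c
  | _, .eq s t, _, _, _, h, h' => fun _ h1 => J.congr fun Γ₂ h2 =>
    exists_congr fun c => and_congr
      (Tm.den_congr s (fun a ha => h a (.inl ha)) h' Γ₂ (h1.trans h2) c)
      (Tm.den_congr t (fun a ha => h a (.inr ha)) h' Γ₂ (h1.trans h2) c)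
  | _, .imp A B, _, _, _, h, h' => fun _ h1 => forall₂_congr fun Γ₂ h2 => imp_congr
      (Fml.force_congr A (fun a ha => h a (.inl ha)) h' Γ₂ (h1.trans h2))
      (Fml.force_congr B (fun a ha => h a (.inr ha)) h' Γ₂ (h1.trans h2))
  | _, .all A, _, _, _, h, h' => fun _ h1 => forall₂_congr fun Γ₂ h2 => forall₂_congr fun _ _ =>
      Fml.force_congr A h (push_agree h') Γ₂ (h1.trans h2)
end

-- Substitution lemma for values and forcing

mutual
theorem Tm.den_ren : ∀ {m : ℕ} (t : Tm S m) {n : ℕ} (f : Fin m → Fin n) (ρ : Fin n → Val S),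
    (t.ren f).den K η ρ = t.den K η (ρ ∘ f)
  | _, .bv _, _, _, _ => rfl
  | _, .par _, _, _, _ => rfl
  | _, .con _, _, _, _ => rfl
  | _, .iota F, _, f, ρ => by
    simp only [Tm.ren, Tm.den, Fml.force_ren F, push_comp_liftRen]
theorem Fml.force_ren : ∀ {m : ℕ} (A : Fml S m) {n : ℕ} (f : Fin m → Fin n) (ρ : Fin n → Val S),
    (A.ren f).force K η ρ = A.force K η (ρ ∘ f)
  | _, .bot, _, _, _ => rfl
  | _, .pred _ ts, _, f, ρ => by
    have := fun k => Tm.den_ren (ts k) f ρ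
    simp only [Fml.ren, Fml.force, this]
  | _, .ex t, _, _, _ => by simp only [Fml.ren, Fml.force, Tm.den_ren t]
  | _, .eq s t, _, _, _ => by simp only [Fml.ren, Fml.force, Tm.den_ren s, Tm.den_ren t]
  | _, .imp A B, _, _, _ => by simp only [Fml.ren, Fml.force, Fml.force_ren A, Fml.force_ren B]
  | _, .all A, _, _, _ => by
    simp only [Fml.ren, Fml.force, Fml.force_ren A, push_comp_liftRen]
end

theorem den_liftSub {m n : ℕ} (f : Fin m → Tm S n) (v : Val S) (ρ : Fin n → Val S) :
    (fun k => (liftSub f k).den K η (push v ρ)) = push v fun k => (f k).den K η ρ := by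
  funext k
  refine Fin.cases rfl (fun k => ?_) k
  rw [liftSub_succ, Tm.den_ren, push_succ]
  rfl

mutual
theorem Tm.den_subst : ∀ {m : ℕ} (t : Tm S m) {n : ℕ} (f : Fin m → Tm S n) (ρ : Fin n → Val S),
    (t.subst f).den K η ρ = t.den K η fun k => (f k).den K η ρ
  | _, .bv _, _, _, _ => rfl
  | _, .par _, _, _, _ => rfl
  | _, .con _, _, _, _ => rfl
  | _, .iota F, _, f, ρ => by
    simp only [Tm.subst, Tm.den, Fml.force_subst F, den_liftSub]
theorem Fml.force_subst : ∀ {m : ℕ} (A : Fml S m) {n : ℕ} (f : Fin m → Tm S n)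
    (ρ : Fin n → Val S), (A.subst f).force K η ρ = A.force K η fun k => (f k).den K η ρ
  | _, .bot, _, _, _ => rfl
  | _, .pred _ ts, _, f, ρ => by
    have := fun k => Tm.den_subst (ts k) f ρ
    simp only [Fml.subst, Fml.force, this]
  | _, .ex t, _, _, _ => by simp only [Fml.subst, Fml.force, Tm.den_subst t]
  | _, .eq s t, _, _, _ => by simp only [Fml.subst, Fml.force, Tm.den_subst s, Tm.den_subst t]
  | _, .imp A B, _, _, _ => by
    simp only [Fml.subst, Fml.force, Fml.force_subst A, Fml.force_subst B]
  | _, .all A, _, _, _ => by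
    simp only [Fml.subst, Fml.force, Fml.force_subst A, den_liftSub]
end

theorem Fml.force_inst (A : Fml S 1) (t : Tm S 0) (ρ : Fin 0 → Val S) :
    (A.inst t).force K η ρ = A.force K η (push (t.den K η ρ) ρ) := by
  rw [Fml.inst, Fml.force_subst]
  congr 1
  funext k
  rw [Subsingleton.elim k 0]
  rfl

/-- Proper values: those of terms that denote at most one object, and any object in inconsistent
worlds. -/
structure Val.IsProper (K : ℕ) (v : Val S) : Prop where
  ex : ∀ {Γ c}, v Γ c → Nf K Γ.1 (.ex c.1)
  iff : ∀ {Γ c}, v Γ c → ∀ Γ' ≥ Γ, ∀ d, v Γ' d ↔ EqAt K Γ' c d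
  of_bot : ∀ {Γ}, Nf K Γ.1 .bot → ∀ c, v Γ c

theorem Val.IsProper.mono {v : Val S} (hv : v.IsProper K) {c : Atom S} (h : v Γ c)
    (hΓ : Γ ≤ Γ') : v Γ' c :=
  (hv.iff h _ hΓ c).2 (EqAt.refl ((hv.ex h).mono hΓ))

theorem Val.IsProper.agree {v w : Val S} (hv : v.IsProper K) (hw : w.IsProper K) {c : Atom S}
    (h : v Γ c) (h' : w Γ c) : v.Agree Γ w := fun _ h1 d =>
  (hv.iff h _ h1 d).trans (hw.iff h' _ h1 d).symm

theorem Atom.isProper_val (c : Atom S) : (c.val K).IsProper K where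
  ex h := h.2.2
  iff h _ h1 _ := ⟨fun h2 => (h.mono h1).symm.trans h2, fun h2 => (h.mono h1).trans h2⟩
  of_bot h _ := EqAt.of_bot h

/-- For a description, two values `c` and `d` agree because `c` satisfies the description by its own
clause and the uniqueness half of the clause for `d` applies to it. -/
theorem Tm.isProper_den (hη : ∀ a, (η a).IsProper K) : ∀ {n : ℕ} (t : Tm S n)
    {ρ : Fin n → Val S}, (∀ k, (ρ k).IsProper K) → (t.den K η ρ).IsProper K
  | _, .bv k, _, h => h k
  | _, .par a, _, _ => hη a
  | _, .con c, _, _ => Atom.isProper_val ⟨.con c, trivial⟩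
  | _, .iota F, ρ, _ => by
    refine ⟨fun h => h.1, fun {Γ c} h Γ' h1 d => ⟨fun h2 => ?_, fun h2 => ?_⟩, fun {Γ} h c => ?_⟩
    · have hc := h.1.mono h1
      exact (h2.2 Γ' le_rfl c).2 ((h.2 Γ' h1 c).1 (EqAt.refl hc)) hc
    · refine ⟨h2.2.2, fun Γ₂ h3 u => ?_⟩
      have h4 := h.2 Γ₂ (h1.trans h3) u
      have h5 := h2.mono h3
      exact ⟨fun h6 => h4.1 (h6.trans h5.symm), fun h6 h7 => (h4.2 h6 h7).trans h5⟩
    · exact ⟨h.exfalso_prime c.prime_ex, fun Γ' h1 u => ⟨fun _ => Fml.force_of_bot (h.mono h1),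
        fun _ _ => EqAt.of_bot (h.mono h1)⟩⟩

end Forcing

section Soundness

variable {K : ℕ}



/-! ### Soundness -/

theorem Fml.force_update {n : ℕ} {A : Fml S n} {a : ℕ} (ha : ¬ A.HasPar a) (η : ℕ → Val S)
    (v : Val S) (ρ : Fin n → Val S) (Γ : World S) :
    A.force K (Function.update η a v) ρ Γ ↔ A.force K η ρ Γ := by
  refine A.force_congr (fun b hb => ?_) (fun _ => .rfl) Γ le_rfl
  rw [Function.update_of_ne (by rintro rfl; exact ha hb)]
  exact .rfl

theorem Tm.den_update {n : ℕ} {t : Tm S n} {a : ℕ} (ha : ¬ t.HasPar a) (η : ℕ → Val S)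
    (v : Val S) (ρ : Fin n → Val S) (Γ : World S) (c : Atom S) :
    t.den K (Function.update η a v) ρ Γ c ↔ t.den K η ρ Γ c := by
  refine t.den_congr (fun b hb => ?_) (fun _ => .rfl) Γ le_rfl c
  rw [Function.update_of_ne (by rintro rfl; exact ha hb)]
  exact .rfl

theorem Fml.force_inst_update {A : Fml S 1} {a : ℕ} (ha : ¬ A.HasPar a) (η : ℕ → Val S)
    (v : Val S) (ρ : Fin 0 → Val S) (Γ : World S) :
    (A.inst (.par a)).force K (Function.update η a v) ρ Γ ↔ A.force K η (push v ρ) Γ := by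
  rw [Fml.force_inst, Fml.force_update ha]
  simp only [Tm.den, Function.update_self]

/-- Forcing of an instance depends only on the value of the term. -/
theorem Fml.force_inst_iff {A : Fml S 1} {η : ℕ → Val S} {ρ : Fin 0 → Val S} {t : Tm S 0}
    {v : Val S} {Γ : World S} (h : Val.Agree Γ (t.den K η ρ) v) :
    (A.inst t).force K η ρ Γ ↔ A.force K η (push v ρ) Γ := by
  rw [Fml.force_inst]
  refine A.force_congr (fun _ _ => .rfl) (fun k => ?_) Γ le_rfl
  rw [Subsingleton.elim k 0]
  exact h

/-- The valuation `η` is arbitrary so that the induction hypothesis can be used with another value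
for a restricted parameter. -/
theorem Ded.Correct.force : ∀ {D : Ded S}, D.Correct → ∀ {η : ℕ → Val S},
    (∀ a, (η a).IsProper K) → ∀ {ρ : Fin 0 → Val S} {Γ : World S},
    (∀ c ∈ D.openAsm, c.2.force K η ρ Γ) → D.concl.force K η ρ Γ := by
  intro D
  induction D with
  | node r ds ih =>
  rintro ⟨h1, h2, hok, heig, -⟩ η hη ρ Γ hΓ
  have hρ : ∀ k, (ρ k).IsProper K := fun k => k.elim0
  have hupd : ∀ (a : ℕ) (c : Atom S) b, (Function.update η a (c.val K) b).IsProper K := by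
    intro a c b
    rcases eq_or_ne b a with rfl | hb
    · rw [Function.update_self]; exact c.isProper_val
    · rw [Function.update_of_ne hb]; exact hη b
  have prem : ∀ n : Fin r.prems.length, ∀ Γ' ≥ Γ, (∀ c ∈ r.disch n, c.2.force K η ρ Γ') →
      (r.prems.get n).force K η ρ Γ' := by
    intro n Γ' hΓ' hd
    rw [← h2 n]
    refine ih n (h1 n) hη fun c hc => ?_
    by_cases hcd : c ∈ r.disch n
    · exact hd c hcd
    · exact c.2.force_mono (hΓ c (.inr (Set.mem_iUnion.2 ⟨n, hc, hcd⟩))) hΓ'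
  -- The restricted parameter gets the value of an arbitrary atomic term `d`; assumptions that are
  -- not discharged do not contain it and remain forced.
  have prem' : ∀ (n : Fin r.prems.length) (a : ℕ), r.eigen n = some a → ∀ d : Atom S, ∀ Γ' ≥ Γ,
      (∀ c ∈ r.disch n, c.2.force K (Function.update η a (d.val K)) ρ Γ') →
      (r.prems.get n).force K (Function.update η a (d.val K)) ρ Γ' := by
    intro n a ha d Γ' hΓ' hd
    rw [← h2 n]
    refine ih n (h1 n) (hupd a d) fun c hc => ?_
    by_cases hcd : c ∈ r.disch n
    · exact hd c hcd
    · rw [Fml.force_update (heig n a ha c hc hcd)]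
      exact c.2.force_mono (hΓ c (.inr (Set.mem_iUnion.2 ⟨n, hc, hcd⟩))) hΓ'
  clear ih h1 h2 heig
  have hval : ∀ {Γ' : World S} {u : Atom S} {t : Tm S 0} {c : Atom S}, EqAt K Γ' u c →
      t.den K η ρ Γ' c → Val.Agree Γ' (t.den K η ρ) (u.val K) := fun h h' =>
    (Tm.isProper_den hη _ hρ).agree (Atom.isProper_val _) h' h
  cases r with
  | asm i A => exact hΓ (i, A) (.inl rfl)
  | impI i A B =>
    intro Γ' hΓ' hA
    exact prem ⟨0, by simp [Rule.prems]⟩ Γ' hΓ' (by rintro c rfl; exact hA)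
  | impE A B =>
    have h1 : (Fml.imp A B).force K η ρ Γ :=
      prem ⟨0, by simp [Rule.prems]⟩ Γ le_rfl (by rintro c ⟨⟩)
    exact h1 Γ le_rfl (prem ⟨1, by simp [Rule.prems]⟩ Γ le_rfl (by rintro c ⟨⟩))
  | botC i A =>
    -- The hypothesis of `J` is, by definition, forcing of `¬ A`.
    refine A.force_of_J fun Γ' hΓ' hA => ?_
    exact prem ⟨0, by simp [Rule.prems]⟩ Γ' hΓ' (by rintro c rfl; exact hA)
  | allI i a A =>
    intro Γ' hΓ' u hu
    refine (Fml.force_inst_update hok η (u.val K) ρ Γ').1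
      (prem' ⟨0, by simp [Rule.prems]⟩ a rfl u Γ' hΓ' ?_)
    rintro c rfl
    refine J.intro fun Γ₂ h2 => ⟨u, ?_⟩
    simp only [Tm.den, Function.update_self]
    exact EqAt.refl (hu.mono h2)
  | allE A t =>
    have h1 := prem ⟨0, by simp [Rule.prems]⟩ Γ le_rfl (by rintro c ⟨⟩)
    have h2 := prem ⟨1, by simp [Rule.prems]⟩ Γ le_rfl (by rintro c ⟨⟩)
    refine Fml.force_bind (A := A.inst t) h2 ?_
    rintro Γ' hΓ' ⟨c, hc⟩
    have hex := (Tm.isProper_den hη _ hρ).ex hc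
    exact (Fml.force_inst_iff (hval (EqAt.refl hex) hc)).2 (h1 Γ' hΓ' c hex)
  | eqI i a t C =>
    have h1 := prem ⟨0, by simp [Rule.prems]⟩ Γ le_rfl (by rintro c ⟨⟩)
    refine Fml.force_bind (A := C) h1 ?_
    rintro Γ' hΓ' ⟨d, hd⟩
    refine (Fml.force_update hok.2 η (d.val K) ρ Γ').1
      (prem' ⟨1, by simp [Rule.prems]⟩ a rfl d Γ' hΓ' ?_)
    rintro c rfl
    refine J.intro fun Γ₂ h2 => ⟨d, ?_, ?_⟩
    · simp only [Tm.den, Function.update_self]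
      exact EqAt.refl (((Tm.isProper_den hη _ hρ).ex hd).mono h2)
    · rw [Tm.den_update hok.1]
      exact (Tm.isProper_den hη _ hρ).mono hd h2
  | eqE A s t =>
    have h1 := prem ⟨0, by simp [Rule.prems]⟩ Γ le_rfl (by rintro c ⟨⟩)
    have h2 := prem ⟨1, by simp [Rule.prems]⟩ Γ le_rfl (by rintro c ⟨⟩)
    refine Fml.force_bind (A := A.inst t) h1 ?_
    rintro Γ' hΓ' ⟨c, hs, ht⟩
    have hc := EqAt.refl ((Tm.isProper_den hη _ hρ).ex hs)
    exact (Fml.force_inst_iff (hval hc ht)).2 ((Fml.force_inst_iff (hval hc hs)).1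
      ((A.inst s).force_mono h2 hΓ'))
  | ad A t =>
    have h1 := prem ⟨0, by simp [Rule.prems]⟩ Γ le_rfl (by rintro c ⟨⟩)
    obtain ⟨hok, -⟩ := hok
    cases A with
    | pred R ts =>
      obtain ⟨k, rfl⟩ := hok
      exact J.imp h1 fun Γ' _ ⟨c, hc, _⟩ => ⟨c k, hc k⟩
    | eq s u =>
      rcases hok with rfl | rfl
      · exact J.imp h1 fun Γ' _ ⟨c, hc, _⟩ => ⟨c, hc⟩
      · exact J.imp h1 fun Γ' _ ⟨c, _, hc⟩ => ⟨c, hc⟩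
    | _ => exact hok.elim
  | iotaI i j k a F t =>
    obtain ⟨-, hF, ht⟩ := hok
    have h1 := prem ⟨0, by simp [Rule.prems]⟩ Γ le_rfl (by rintro c ⟨⟩)
    refine J.imp h1 ?_
    rintro Γ' hΓ' ⟨c, hc⟩
    have hpt := Tm.isProper_den hη t hρ
    -- A value `c` of `t` is shown to be a value of the description as well: the second premise
    -- gives satisfaction, the third uniqueness.
    refine ⟨c, ⟨hpt.ex hc, fun Γ₂ h2 u => ⟨fun hu => ?_, fun hu hex => ?_⟩⟩, hc⟩
    · refine (Fml.force_inst_update hF η (u.val K) ρ Γ₂).1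
        (prem' ⟨1, by simp [Rule.prems]⟩ a rfl u Γ₂ (hΓ'.trans h2) ?_)
      rintro _ rfl
      refine J.intro fun Γ₃ h3 => ⟨c, ?_, ?_⟩
      · simp only [Tm.den, Function.update_self]
        exact hu.mono h3
      · rw [Tm.den_update ht]
        exact hpt.mono hc (h2.trans h3)
    · have h3 := prem' ⟨2, by simp [Rule.prems]⟩ a rfl u Γ₂ (hΓ'.trans h2) ?_
      · refine EqAt.of_J (J.imp h3 ?_)
        rintro Γ₃ h4 ⟨d, hd, hd'⟩
        rw [Tm.den_update ht] at hd'
        simp only [Tm.den, Function.update_self] at hd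
        exact EqAt.trans hd ((hpt.iff hc Γ₃ (h2.trans h4) d).1 hd').symm
      · rintro _ (rfl | rfl)
        · exact (Fml.force_inst_update hF η (u.val K) ρ Γ₂).2 hu
        · refine J.intro fun Γ₃ h3 => ⟨u, ?_⟩
          simp only [Tm.den, Function.update_self]
          exact EqAt.refl (hex.mono h3)
  | iotaE₁ F t u =>
    have h1 := prem ⟨0, by simp [Rule.prems]⟩ Γ le_rfl (by rintro c ⟨⟩)
    have h2 := prem ⟨1, by simp [Rule.prems]⟩ Γ le_rfl (by rintro c ⟨⟩)
    refine Fml.force_bind (A := F.inst u) h1 ?_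
    rintro Γ' hΓ' ⟨c, hF, ht⟩
    refine Fml.force_bind (J.mono h2 hΓ') ?_
    rintro Γ₂ hΓ₂ ⟨d, hu, ht'⟩
    have hcd := ((Tm.isProper_den hη t hρ).iff ht Γ₂ hΓ₂ d).1 ht'
    exact (Fml.force_inst_iff (hval (EqAt.refl hcd.2.2) hu)).2 ((hF.2 Γ₂ hΓ₂ d).1 hcd.symm)
  | iotaE₂ F t u =>
    have h1 := prem ⟨0, by simp [Rule.prems]⟩ Γ le_rfl (by rintro c ⟨⟩)
    have h2 := prem ⟨1, by simp [Rule.prems]⟩ Γ le_rfl (by rintro c ⟨⟩)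
    have h3 := prem ⟨2, by simp [Rule.prems]⟩ Γ le_rfl (by rintro c ⟨⟩)
    refine J.bind h1 ?_
    rintro Γ' hΓ' ⟨c, hF, ht⟩
    refine J.imp (J.mono h3 hΓ') ?_
    rintro Γ₂ hΓ₂ ⟨d, hu⟩
    have hpu := Tm.isProper_den hη u hρ
    have hex := hpu.ex hu
    have hd := (Fml.force_inst_iff (hval (EqAt.refl hex) hu)).1
      ((F.inst u).force_mono h2 (hΓ'.trans hΓ₂))
    have hdc := (hF.2 Γ₂ hΓ₂ d).2 hd hex
    exact ⟨c, (hpu.iff hu Γ₂ le_rfl c).2 hdc, (Tm.isProper_den hη t hρ).mono ht hΓ₂⟩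
  | iotaE₃ F t =>
    have h1 := prem ⟨0, by simp [Rule.prems]⟩ Γ le_rfl (by rintro c ⟨⟩)
    exact J.imp h1 fun Γ' _ ⟨c, _, hc⟩ => ⟨c, hc⟩

end Soundness

section Completeness

variable {K : ℕ}



/-! ### Completeness of good deductions -/

/-- The valuation that assigns to every parameter its own value. -/
def parVal (K : ℕ) (a : ℕ) : Val S := (Atom.par a).val K

theorem push_val {n : ℕ} (c : Atom S) (f : Fin n → Atom S) :
    push (c.val K) (fun k => (f k).val K) = fun k => (push c f k).val K := by
  funext k; exact Fin.cases rfl (fun k => rfl) k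

theorem push_coe {n : ℕ} (c : Atom S) (f : Fin n → Atom S) :
    push c.1 (fun k => (f k).1) = fun k => (push c f k).1 := by
  funext k; exact Fin.cases rfl (fun k => rfl) k

theorem Fml.subst_liftSub_inst_atom {n : ℕ} (A : Fml S (n + 1)) (f : Fin n → Atom S)
    (c : Atom S) : (A.subst (liftSub fun k => (f k).1)).inst c.1 =
      A.subst fun k => (push c f k).1 := by
  rw [Fml.subst_liftSub_inst, push_coe]

theorem isProper_parVal_den {n : ℕ} (t : Tm S n) (f : Fin n → Atom S) :
    (t.den K (parVal K) fun k => (f k).val K).IsProper K :=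
  Tm.isProper_den (fun a => (Atom.par a).isProper_val) t fun k => (f k).isProper_val

mutual
-- Existence is delivered together with identity because symmetry of identity needs it.
theorem Tm.reify : ∀ {n : ℕ} (t : Tm S n) (f : Fin n → Atom S) (Γ : World S) (c : Atom S),
    t.den K (parVal K) (fun k => (f k).val K) Γ c →
    Nf K Γ.1 (.eq (t.subst fun k => (f k).1) c.1) ∧ Nf K Γ.1 (.ex (t.subst fun k => (f k).1))
  | _, .bv _, _, _, _, h => ⟨h.1, h.2.1⟩
  | _, .par _, _, _, _, h => ⟨h.1, h.2.1⟩
  | _, .con _, _, _, _, h => ⟨h.1, h.2.1⟩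
  | _, .iota F, f, Γ, c, h => by
    obtain ⟨hex, h⟩ := h
    obtain ⟨a, h1, h2, h3⟩ := exists_fresh Γ.2 (Fml.ex c.1) (F.subst (liftSub fun k => (f k).1))
    -- The label `K + 2` avoids both reserved labels, so the discharged assumptions count as
    -- neutral.
    have key := Der.iotaI (K := K) (i := K + 2) (j := K + 2) (k := K + 2) c.2 h3 h2 h1 hex ?_ ?_
    · refine ⟨key.imp subset_rfl ?_, Nf.ad
        (A := .eq (.iota (F.subst (liftSub fun k => (f k).1))) c.1)
        (t := .iota (F.subst (liftSub fun k => (f k).1))) (.inl rfl) ?_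
        (key.imp subset_rfl ?_)⟩
      · rintro D - ⟨_, _, _, _, hD⟩ A hA
        rw [hA] at hD; cases hD
      -- The instance is not a case of `iotaE₃`: that would make the atomic term `c` a description.
      · intro F' hF'
        have h4 := c.2
        rw [(Fml.eq.inj hF').2] at h4
        exact h4
      · rintro D - ⟨_, _, _, _, hD⟩
        simp only [NotCont, hD]
        exact ⟨by rintro A ⟨⟩, id, id, id, by rintro b s ⟨⟩⟩
    · have hn : Ne K (Γ.ins (K + 2, .eq (.par a) c.1)).1 (.eq (.par a) c.1) :=
        Ne.asm (.inl rfl) (by simp) (by simp)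
      have h4 := (h _ (World.le_ins (K + 2, .eq (.par a) c.1) Γ) (Atom.par a)).1
        ⟨hn.nf, hn.ad_left, hn.ad_right⟩
      have h5 := Fml.reify F (push (Atom.par a) f) _ (by rw [← push_val]; exact h4)
      rwa [← Fml.subst_liftSub_inst_atom] at h5
    · have hsub := (World.le_ins (K + 2, .ex (.par a)) Γ).trans (World.le_ins (K + 2,
        (F.subst (liftSub fun k => (f k).1)).inst (.par a)) _)
      have h4 := Fml.reflect F (push (Atom.par a) f) _ (by
        rw [← Fml.subst_liftSub_inst_atom]
        exact Ne.asm (Γ := (World.ins (K + 2, (F.subst (liftSub fun k => (f k).1)).inst (.par a))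
          (World.ins (K + 2, .ex (.par a)) Γ)).1) (.inl rfl) (by simp) (by simp))
      rw [← push_val] at h4
      exact ((h _ hsub (Atom.par a)).2 h4 (Nf.asm (i := K + 2) (.inr (.inl rfl)) (by simp))).1
-- The assumption `a = t` made by `eqI` supplies the parameter `a` as an atomic value of `t`.
theorem Tm.reflect : ∀ {n : ℕ} (t : Tm S n) (f : Fin n → Atom S) (Γ : World S) (a : ℕ),
    (K + 1, .eq (.par a) (t.subst fun k => (f k).1)) ∈ Γ.1 →
    ¬ (t.subst fun k => (f k).1).HasPar a → Nf K Γ.1 (.ex (t.subst fun k => (f k).1)) →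
    t.den K (parVal K) (fun k => (f k).val K) Γ (Atom.par a)
  | _, .bv _, _, Γ, _, h, ha, hex => ⟨(Nf.asm h (by simp)).symm Γ.2 (Nf.ex_par h ha), hex,
    Nf.ex_par h ha⟩
  | _, .par _, _, Γ, _, h, ha, hex => ⟨(Nf.asm h (by simp)).symm Γ.2 (Nf.ex_par h ha), hex,
    Nf.ex_par h ha⟩
  | _, .con _, _, Γ, _, h, ha, hex => ⟨(Nf.asm h (by simp)).symm Γ.2 (Nf.ex_par h ha), hex,
    Nf.ex_par h ha⟩
  | _, .iota F, f, Γ, a, h, ha, _ => by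
    have hea := Nf.ex_par h ha
    have hm : Der K (Major K) Γ.1
        (.eq (.iota (F.subst (liftSub fun k => (f k).1))) (.par a)) := by
      -- Replacing the left `a` in `a = a` makes `eqE` the last rule, so that the identity can be
      -- the major premise of `iotaE₁` and `iotaE₂`; symmetry as such yields only `Nf`.
      have := Der.eqE (K := K) (Γ := Γ.1) (A := .eq (.bv 0) (.par a)) (s := .par a)
        (t := .iota (F.subst (liftSub fun k => (f k).1))) trivial (fun h => by cases h)
        (fun u h => by cases h) (Nf.asm h (by simp)) (hea.refl Γ.2)
      exact this
    refine ⟨hea, fun Γ' h1 u => ⟨fun hu => ?_, fun hu hex => ?_⟩⟩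
    · have h2 := Ne.iotaE₁ (t := .par a) (u := u.1) (Atom.par a).2 u.2 (hm.mono h1) hu.1
      rw [Fml.subst_liftSub_inst_atom] at h2
      have h3 := Fml.reflect F (push u f) Γ' h2
      rwa [← push_val] at h3
    · have h2 := Fml.reify F (push u f) Γ' (by rw [← push_val]; exact hu)
      rw [← Fml.subst_liftSub_inst_atom] at h2
      exact ⟨(Ne.iotaE₂ (t := .par a) (Atom.par a).2 u.2 (hm.mono h1) h2 hex).nf, hex, hea.mono h1⟩
theorem Fml.reify : ∀ {n : ℕ} (A : Fml S n) (f : Fin n → Atom S) (Γ : World S),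
    A.force K (parVal K) (fun k => (f k).val K) Γ → Nf K Γ.1 (A.subst fun k => (f k).1)
  | _, .bot, _, _, h => h
  | _, .pred R ts, f, Γ, h => by
    have core : ∀ Γ' ≥ Γ, (∃ c : Fin (S.ar R) → Atom S,
        (∀ k, (ts k).den K (parVal K) (fun k => (f k).val K) Γ' (c k)) ∧
        Nf K Γ'.1 (.pred R fun k => (c k).1)) →
        Nf K Γ'.1 (.pred R fun k => (ts k).subst fun k => (f k).1) := by
      rintro Γ' - ⟨c, hc, hR⟩
      refine Nf.pred_replace (fun k => ?_) hR
      have hk := Tm.reify (ts k) f Γ' (c k) (hc k)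
      exact hk.1.symm Γ'.2 hk.2
    -- In an inconsistent world every term has every value, so `core` applies with the arbitrary
    -- parameter `0`; this supplies ex falso for formulas that are not prime.
    exact J.nf trivial (fun hb => core Γ le_rfl ⟨fun _ => Atom.par 0,
      fun k => (isProper_parVal_den (ts k) f).of_bot hb _,
      hb.exfalso_prime fun _ => trivial⟩) (J.imp h core)
  | _, .ex t, f, Γ, h => J.nf trivial
    (fun hb => (Tm.reify t f Γ (Atom.par 0) ((isProper_parVal_den t f).of_bot hb _)).2)
    (J.imp h fun Γ' _ ⟨c, hc⟩ => (Tm.reify t f Γ' c hc).2)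
  | _, .eq s t, f, Γ, h => by
    have core : ∀ Γ' ≥ Γ, (∃ c, s.den K (parVal K) (fun k => (f k).val K) Γ' c ∧
        t.den K (parVal K) (fun k => (f k).val K) Γ' c) →
        Nf K Γ'.1 (.eq (s.subst fun k => (f k).1) (t.subst fun k => (f k).1)) := by
      rintro Γ' - ⟨c, hs, ht⟩
      have hs' := Tm.reify s f Γ' c hs
      have ht' := Tm.reify t f Γ' c ht
      exact (ht'.1.symm Γ'.2 ht'.2).eq_replace_right hs'.1
    exact J.nf trivial (fun hb => core Γ le_rfl ⟨Atom.par 0,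
      (isProper_parVal_den s f).of_bot hb _, (isProper_parVal_den t f).of_bot hb _⟩)
      (J.imp h core)
  | _, .imp A B, f, Γ, h => Nf.impI (i := K + 2) (Fml.reify B f
      (Γ.ins (K + 2, A.subst fun k => (f k).1)) (h _ (World.le_ins _ _)
        (Fml.reflect A f _ (Ne.asm (.inl rfl) (by simp) (by simp)))))
  | _, .all A, f, Γ, h => by
    obtain ⟨a, h1, h2, -⟩ := exists_fresh Γ.2 (A.subst (liftSub fun k => (f k).1))
      (A.subst (liftSub fun k => (f k).1))
    refine Nf.allI (i := K + 2) h2 h1 ?_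
    have h3 := h _ (World.le_ins (K + 2, .ex (.par a)) Γ) (Atom.par a)
      (Nf.asm (.inl rfl) (by simp))
    have h4 := Fml.reify A (push (Atom.par a) f) _ (by rw [← push_val]; exact h3)
    rwa [← Fml.subst_liftSub_inst_atom] at h4
theorem Fml.reflect : ∀ {n : ℕ} (A : Fml S n) (f : Fin n → Atom S) (Γ : World S),
    Ne K Γ.1 (A.subst fun k => (f k).1) → A.force K (parVal K) (fun k => (f k).val K) Γ
  | _, .bot, _, _, h => h.nf
  | _, .pred R ts, f, Γ, h => fun Γ' h1 H => by
    have h' : Ne K Γ'.1 (.pred R fun k => (ts k).subst fun k => (f k).1) := h.mono h1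
    have hex := h'.ad_pred
    -- With `J` unfolded the goal is `⊥`, so names for all arguments may be introduced by `eqI`.
    refine Nf.bot_of_names Γ'.2 _ hex fun Γ₂ hfin hsub a ha => ?_
    refine H ⟨Γ₂, hfin⟩ hsub ⟨fun k => Atom.par (a k), fun k => Tm.reflect (ts k) f ⟨Γ₂, hfin⟩
      (a k) (ha k).1 (ha k).2 ((hex k).mono hsub), ?_⟩
    exact Nf.pred_replace (fun k => (Nf.asm (ha k).1 (by simp)).symm hfin
      (Nf.ex_par (ha k).1 (ha k).2)) (h'.nf.mono hsub)
  | _, .ex t, f, Γ, h => fun Γ' h1 H => by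
    have hex := h.nf.mono h1
    refine Nf.bot_of_names (n := 1) Γ'.2 (fun _ => t.subst fun k => (f k).1) (fun _ => hex)
      fun Γ₂ hfin hsub a ha => ?_
    exact H ⟨Γ₂, hfin⟩ hsub ⟨_, Tm.reflect t f ⟨Γ₂, hfin⟩ (a 0) (ha 0).1 (ha 0).2 (hex.mono hsub)⟩
  | _, .eq s t, f, Γ, h => fun Γ' h1 H => by
    have h' : Ne K Γ'.1 (.eq (s.subst fun k => (f k).1) (t.subst fun k => (f k).1)) := h.mono h1
    have hs := h'.ad_left
    have ht := h'.ad_right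
    refine Nf.bot_of_names (n := 2) Γ'.2 (push (s.subst fun k => (f k).1)
      fun _ => t.subst fun k => (f k).1) (fun k => Fin.cases hs (fun _ => ht) k)
      fun Γ₂ hfin hsub a ha => ?_
    obtain ⟨ha1, ha2⟩ := ha 0
    obtain ⟨hb1, hb2⟩ := ha 1
    have hsa := Tm.reflect s f ⟨Γ₂, hfin⟩ (a 0) ha1 ha2 (hs.mono hsub)
    have htb := Tm.reflect t f ⟨Γ₂, hfin⟩ (a 1) hb1 hb2 (ht.mono hsub)
    have hea := Nf.ex_par ha1 ha2
    have heb := Nf.ex_par hb1 hb2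
    have hat := Nf.eq_replace_right (h'.nf.mono hsub) (Nf.asm ha1 (by simp))
    -- From `a = s`, `s = t` and `t = b` the two names are identical, so `a` is a common value of
    -- both terms.
    have hab : EqAt K ⟨Γ₂, hfin⟩ (Atom.par (a 0)) (Atom.par (a 1)) :=
      ⟨Nf.eq_replace_right ((Nf.asm hb1 (by simp)).symm hfin heb) hat, hea, heb⟩
    exact H ⟨Γ₂, hfin⟩ hsub
      ⟨_, hsa, ((isProper_parVal_den t f).iff htb _ le_rfl _).2 hab.symm⟩
  | _, .imp A B, f, Γ, h => fun Γ' h1 hA =>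
    Fml.reflect B f Γ' (Ne.impE (h.major.mono h1) (Fml.reify A f Γ' hA))
  | _, .all A, f, Γ, h => fun Γ' h1 u hu => by
    have h2 := Ne.allE u.2 (h.major.mono h1) hu
    rw [Fml.subst_liftSub_inst_atom] at h2
    have h3 := Fml.reflect A (push u f) Γ' h2
    rwa [← push_val] at h3
end

theorem Ded.finite_openAsm : ∀ D : Ded S, D.openAsm.Finite
  | .node r ds => by
    refine Set.Finite.union ?_ (Set.finite_iUnion fun n => (finite_openAsm (ds n)).sdiff)
    refine Set.Subsingleton.finite ?_
    rintro ⟨i, A⟩ h ⟨j, B⟩ h'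
    have : r = .asm i A := h
    subst this
    cases (show Rule.asm i A = .asm j B from h')
    rfl

/-- Every conclusion of a deduction is the conclusion of a good one. -/
theorem Ded.Correct.nf {D : Ded S} (hD : D.Correct) (hK : ∀ c ∈ D.openAsm, c.1 < K) :
    Nf K D.openAsm D.concl := by
  have h := Fml.reify (K := K) D.concl Fin.elim0 ⟨D.openAsm, D.finite_openAsm⟩ ?_
  · rwa [Fml.subst_closed] at h
  · refine hD.force (fun a => (Atom.par a).isProper_val) fun c hc => ?_
    refine Fml.reflect c.2 Fin.elim0 _ ?_
    rw [Fml.subst_closed]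
    have := hK c hc
    exact Ne.asm (i := c.1) hc (by omega) (by omega)

end Completeness

end NFL

theorem mainTheorem3 (S : NFL.Sig) (D : NFL.Ded S) (hD : D.Correct) :
    ∃ D' : NFL.Ded S, D'.Correct ∧ D'.concl = D.concl ∧ D'.openAsm ⊆ D.openAsm ∧
      D'.Regular ∧ D'.Normal := by
  -- Taking `K = m + 1` puts the reserved labels above all labels of open assumptions.
  obtain ⟨m, hm⟩ := (D.finite_openAsm.image Prod.fst).bddAbove
  obtain ⟨D', h1, h2, h3, h4, -⟩ := hD.nf (K := m + 1)
    fun c hc => Nat.lt_succ_of_le (hm (Set.mem_image_of_mem _ hc))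
  exact ⟨D', h1, h2, h3, h4.regular, h4.normal⟩
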